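/- Let $\Gamma$ be a metric graph that is an interval (a closed interval of positive finite length) or a loop (a circle of positive finite length). Let $r\ge 0$ be an integer, $D$ a divisor on $\Gamma$, and $\Sigma$ a set of real-valued functions on $\Gamma$. Then $(D,\Sigma)$ is a tropical linear series of rank $r$ if and only if it is a combinatorial limit linear series of rank $r$. Here $\mathrm{PL}(\Gamma)$ is the set of continuous piecewise linear functions on $\Gamma$ with integer slopes, $T_v(\Gamma)$ is the set of outgoing tangent vectors at $v$, $\mathrm{val}(v)=|T_v(\Gamma)|$, $\mathrm{sl}_\eta(f)$ is the outgoing slope of $f$ along $\eta$, $\mathrm{div}(f)=\sum_v\bigl(-\sum_{\eta\in T_v(\Gamma)}\mathrm{sl}_\eta(f)\bigr)\,v$, and $R(D)=\{f\in\mathrm{PL}(\Gamma): D+\mathrm{div}(f)\ge 0\}$. A tropical submodule is a set of functions closed under tropical linear combinations $\min_i\{f_i+a_i\}$ ($a_i\in\mathbb R$); it is finitely generated if it is the set of all tropical linear combinations of some finite set of functions. Functions $f_1,\dots,f_n$ are tropically dependent if there are $a_i\in\mathbb R$ such that at every point of $\Gamma$ the minimum of the $f_i+a_i$ is attained at least twice.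 *Tropical linear series of rank $r$*: $\Sigma\subseteq R(D)$ is a finitely generated tropical submodule such that (1) for every effective divisor $E$ of degree $r$ there is $f\in\Sigma$ with $\mathrm{div}(f)+D\ge E$; and (2) every set of $r+2$ functions in $\Sigma$ is tropically dependent. *Permutation arrays.* Let $[r]=\{0,\dots,r\}$ and let $P\subseteq[r]^d$. Call $P$ rankable of rank $s$ if each of the $d$ coordinates takes exactly $s+1$ values on $P$, and totally rankable if $P[x]=\{y\in P: y\ge x\}$ is rankable for every $x\in[r]^d$; then $\rho_P(x)$ denotes the rank of $P[x]$. A point $x\in[r]^d$ is redundant if it is the coordinatewise minimum of a set of at least two elements of $P$, each of which has a coordinate in common with $x$. A permutation array of rank $r$ is a totally rankable $P$ of rank $r$ no element of which is redundant, and $\overline P$ is the union of $P$ and the set of its redundant points. The standard permutation array is $\{x\in[r]^d:\sum_i x_i=r\}$. *Slope structures.* An $r$-slope structure $\mathfrak S$ consists of a finite set $V\subset\Gamma$ containing all points of valence $\ne 2$, integers $s_0^\eta<\dots<s_r^\eta$ for every $v\in\Gamma$ and $\eta\in T_v(\Gamma)$, and a permutation array $P_v$ of rank $r$ with coordinates indexed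 by $T_v(\Gamma)$ for every $v\in\Gamma$, such that: in each connected component of $\Gamma\setminus V$, the sequence $(s_i^\eta)_i$ is the same for all tangent vectors $\eta$ of the component oriented in the same direction (including those based at a boundary point and pointing into the component), and $s_i^\eta+s_{r-i}^\xi=0$ if $\xi$ is oriented in the direction opposite to $\eta$; and $P_v$ is the standard permutation array of rank $r$ and dimension $2$ for all $v\notin V$. A function $f\in\mathrm{PL}(\Gamma)$ is compatible with $\mathfrak S$ if at every $v$ and for every $\eta\in T_v(\Gamma)$ the slope $\mathrm{sl}_\eta(f)$ is some $s^\eta_{j_\eta}$, and the vector $\partial_v(f)=(j_\eta)_{\eta\in T_v(\Gamma)}$ lies in $\overline{P_v}$; then $\rho_v(f):=\rho_{P_v}(\partial_v(f))$. *Combinatorial limit linear series of rank $r$*: $\Sigma\subseteq R(D)$ is a finitely generated tropical submodule, closed in $\mathrm{PL}(\Gamma)$ for the topology of the sup norm, every set of $r+2$ functions in $\Sigma$ is tropically dependent, and there is an $r$-slope structure $\mathfrak S$ such that all functions in $\Sigma$ are compatible with $\mathfrak S$ and for every effective divisor $E$ of degree $r$ there is $f\in\Sigma$ with $\mathrm{div}(f)+D\ge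 E$ and $\rho_v(f)\ge E(v)$ for all $v\in\Gamma$. -/

import Mathlib

/-! ### Dot arrays

A dot array in `[r]^ι`, where `[r] = {0, …, r}`.  The coordinates are indexed by an arbitrary
finite type `ι`; the dimension is the number of elements of `ι`.  The order on `ι → Fin (r + 1)` is
the coordinatewise one. -/

abbrev DotArray (ι : Type*) (r : ℕ) := Set (ι → Fin (r + 1))

namespace DotArray

variable {ι : Type*} {r : ℕ}

/-- The principal subarray `P[x]`: the dots `y ∈ P` with `x ≤ y`. -/
def principal (P : DotArray ι r) (x : ι → Fin (r + 1)) : DotArray ι r :=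
  {y | y ∈ P ∧ x ≤ y}

/-- One less than the number of values taken by the `i`-th coordinate on `P`. -/
noncomputable def axisRank (P : DotArray ι r) (i : ι) : ℤ :=
  (((fun x : ι → Fin (r + 1) => x i) '' P).ncard : ℤ) - 1

/-- `P` is rankable of rank `s`. -/
def HasRank (P : DotArray ι r) (s : ℤ) : Prop :=
  ∀ i, P.axisRank i = s

def TotallyRankable (P : DotArray ι r) : Prop :=
  ∀ x, ∃ s, (P.principal x).HasRank s

open Classical in
/-- The rank array `ρ_P(x) = rank P[x]` (with a default value where `P[x]` is not rankable). -/
noncomputable def rankArray (P : DotArray ι r) (x : ι → Fin (r + 1)) : ℤ :=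
  if h : ∃ s, (P.principal x).HasRank s then h.choose else -1

theorem rankArray_eq [Nonempty ι] {P : DotArray ι r} {x : ι → Fin (r + 1)} {s : ℤ}
    (h : (P.principal x).HasRank s) : P.rankArray x = s := by
  have h' : ∃ s, (P.principal x).HasRank s := ⟨s, h⟩
  obtain ⟨i⟩ := (inferInstance : Nonempty ι)
  rw [rankArray, dif_pos h', ← h'.choose_spec i, h i]

/-- `x` is redundant: it is the meet of a set of at least two dots, each of which has a
coordinate in common with `x`. -/
def Redundant (P : DotArray ι r) (x : ι → Fin (r + 1)) : Prop :=
  ∃ H : Finset (ι → Fin (r + 1)), (H : Set (ι → Fin (r + 1))) ⊆ P ∧ 2 ≤ H.card ∧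
    IsGLB (H : Set (ι → Fin (r + 1))) x ∧ ∀ y ∈ H, ∃ i, y i = x i

/-- A permutation array of rank `r`: totally rankable of rank `r` with no redundant dot. -/
def IsPermutationArray (P : DotArray ι r) : Prop :=
  P.TotallyRankable ∧ P.HasRank r ∧ ∀ x ∈ P, ¬ P.Redundant x

def redundantClosure (P : DotArray ι r) : DotArray ι r :=
  P ∪ {x | P.Redundant x}

/-- The standard permutation array of rank `r`. -/
def standard (ι : Type*) [Fintype ι] (r : ℕ) : DotArray ι r :=
  {x | ∑ i, (x i : ℕ) = r}

end DotArray

/-! ### Metric graphs -/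

/-- A metric graph, given by a model: a (multi)graph with vertex set `V` and edge set `E`
(both finite in all uses below; loops and multiple edges are allowed), each edge `e` being a real
interval `[0, len e]` of positive length glued to its end vertices `src e` and `tgt e`. -/
structure MetricGraph (V E : Type*) where
  src : E → V
  tgt : E → V
  len : E → ℝ
  len_pos : ∀ e, 0 < len e

namespace MetricGraph

variable {V E : Type*}

/-- `Γ` is an interval: any model of an interval is a path `v₀ — v₁ — ⋯ — vₙ₊₁`. -/
def IsInterval (Γ : MetricGraph V E) : Prop :=
  ∃ (n : ℕ) (v : Fin (n + 2) ≃ V) (e : Fin (n + 1) ≃ E), ∀ i,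
    s(Γ.src (e i), Γ.tgt (e i)) = s(v i.castSucc, v i.succ)

/-- `Γ` is a loop: any model of a loop is a cycle `v₀ — v₁ — ⋯ — vₙ — v₀` with `n + 1` edges
(addition in `Fin (n + 1)` is modulo `n + 1`). -/
def IsLoop (Γ : MetricGraph V E) : Prop :=
  ∃ (n : ℕ) (v : Fin (n + 1) ≃ V) (e : Fin (n + 1) ≃ E), ∀ i,
    s(Γ.src (e i), Γ.tgt (e i)) = s(v i, v (i + 1))

/-- The points of `Γ`: its vertices and the points of the open edges. -/
inductive Point (Γ : MetricGraph V E) where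
  | vertex (v : V) : Point Γ
  | inner (e : E) (t : ℝ) (h0 : 0 < t) (h1 : t < Γ.len e) : Point Γ

open Classical in
/-- The point of the closed edge `e` at parameter `t ∈ [0, len e]`. -/
noncomputable def edgePoint (Γ : MetricGraph V E) (e : E) (t : ℝ) : Γ.Point :=
  if h0 : 0 < t then
    if h1 : t < Γ.len e then .inner e t h0 h1 else .vertex (Γ.tgt e)
  else .vertex (Γ.src e)

/-- `(e, true)` is an outgoing direction at `x` if one can leave `x` along `e` with increasing
parameter, and `(e, false)` if one can leave `x` along `e` with decreasing parameter. -/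
def IsDirection (Γ : MetricGraph V E) : Γ.Point → E × Bool → Prop
  | .vertex v, (e, true) => Γ.src e = v
  | .vertex v, (e, false) => Γ.tgt e = v
  | .inner e' _ _ _, (e, _) => e = e'

/-- The outgoing tangent vectors `T_x(Γ)` at a point. -/
def Tangent (Γ : MetricGraph V E) (x : Γ.Point) : Type _ :=
  {η : E × Bool // Γ.IsDirection x η}

noncomputable instance [Fintype E] (Γ : MetricGraph V E) (x : Γ.Point) :
    Fintype (Γ.Tangent x) := by
  classical
  exact (inferInstance : Fintype {η : E × Bool // Γ.IsDirection x η})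

noncomputable def valence (Γ : MetricGraph V E) (x : Γ.Point) : ℕ := Nat.card (Γ.Tangent x)

/-- The edge along which a tangent vector points. -/
def Tangent.edge {Γ : MetricGraph V E} {x : Γ.Point} (η : Γ.Tangent x) : E := η.1.1

/-- Whether a tangent vector points in the direction of increasing edge parameter. -/
def Tangent.forward {Γ : MetricGraph V E} {x : Γ.Point} (η : Γ.Tangent x) : Bool := η.1.2

/-- The parameter, on the edge of the tangent vector `η`, of its base point. -/
def Tangent.pos {Γ : MetricGraph V E} : {x : Γ.Point} → Γ.Tangent x → ℝ
  | .vertex _, η => if η.forward then 0 else Γ.len η.edge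
  | .inner _ t _ _, _ => t

/-- The point at (small) distance `h` from the base point of `η`, in the direction of `η`. -/
noncomputable def Tangent.step {Γ : MetricGraph V E} {x : Γ.Point} (η : Γ.Tangent x) (h : ℝ) :
    Γ.Point :=
  Γ.edgePoint η.edge (if η.forward then η.pos + h else η.pos - h)

/-! ### Piecewise linear functions, divisors, tropical combinations -/

/-- `PL(Γ)`: the continuous piecewise linear functions with integer slopes.  On each closed edge
`f` is affine with integer slope on every closed segment whose interior avoids some finite set of
break points; as the segments are closed and the end points of edges are the vertices of `Γ`,
continuity is included. -/
def PL (Γ : MetricGraph V E) : Set (Γ.Point → ℝ) :=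
  {f | ∀ e, ∃ B : Finset ℝ, ∀ a b, 0 ≤ a → a < b → b ≤ Γ.len e → (∀ t ∈ Set.Ioo a b, t ∉ B) →
    ∃ s : ℤ, ∀ t ∈ Set.Icc a b, f (Γ.edgePoint e t) = f (Γ.edgePoint e a) + s * (t - a)}

/-- `f` has outgoing slope `s` along `η`. -/
def HasSlope {Γ : MetricGraph V E} (f : Γ.Point → ℝ) {x : Γ.Point} (η : Γ.Tangent x) (s : ℤ) :
    Prop :=
  ∃ ε > 0, ∀ h ∈ Set.Icc (0 : ℝ) ε, f (η.step h) = f x + s * h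

open Classical in
/-- The outgoing slope `sl_η(f)`; meaningful for `f ∈ PL(Γ)`, see `slope_eq` and
`exists_hasSlope`. -/
noncomputable def slope {Γ : MetricGraph V E} (f : Γ.Point → ℝ) {x : Γ.Point}
    (η : Γ.Tangent x) : ℤ :=
  if h : ∃ s, HasSlope f η s then h.choose else 0

theorem HasSlope.unique {Γ : MetricGraph V E} {f : Γ.Point → ℝ} {x : Γ.Point}
    {η : Γ.Tangent x} {s s' : ℤ} (h : HasSlope f η s) (h' : HasSlope f η s') : s = s' := by
  obtain ⟨ε, hε, h⟩ := h
  obtain ⟨ε', hε', h'⟩ := h'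
  have hm : 0 < min ε ε' := lt_min hε hε'
  have h1 := h (min ε ε') ⟨hm.le, min_le_left _ _⟩
  have h2 := h' (min ε ε') ⟨hm.le, min_le_right _ _⟩
  have h3 : (s : ℝ) * min ε ε' = s' * min ε ε' := by linarith
  exact_mod_cast mul_right_cancel₀ hm.ne' h3

theorem HasSlope.slope_eq {Γ : MetricGraph V E} {f : Γ.Point → ℝ} {x : Γ.Point}
    {η : Γ.Tangent x} {s : ℤ} (h : HasSlope f η s) : slope f η = s := by
  have h' : ∃ s, HasSlope f η s := ⟨s, h⟩
  rw [slope, dif_pos h']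
  exact h'.choose_spec.unique h

theorem Tangent.edgePoint_pos {Γ : MetricGraph V E} {x : Γ.Point} (η : Γ.Tangent x) :
    Γ.edgePoint η.edge η.pos = x := by
  obtain ⟨⟨e, b⟩, hη⟩ := η
  rcases x with v | ⟨e', t, h0, h1⟩
  · cases b
    · have hη : Γ.tgt e = v := hη
      simp [Tangent.pos, Tangent.forward, Tangent.edge, edgePoint, Γ.len_pos, hη]
    · have hη : Γ.src e = v := hη
      simp [Tangent.pos, Tangent.forward, Tangent.edge, edgePoint, hη]
  · have hη : e = e' := by cases b <;> exact hη
    subst hη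
    simp [Tangent.pos, Tangent.edge, edgePoint, h0, h1]

theorem Tangent.pos_bounds {Γ : MetricGraph V E} {x : Γ.Point} (η : Γ.Tangent x) :
    0 ≤ η.pos ∧ η.pos ≤ Γ.len η.edge ∧ (η.forward = true → η.pos < Γ.len η.edge) ∧
      (η.forward = false → 0 < η.pos) := by
  obtain ⟨⟨e, b⟩, hη⟩ := η
  have hl := Γ.len_pos e
  rcases x with v | ⟨e', t, h0, h1⟩
  · cases b <;> simp [Tangent.pos, Tangent.forward, Tangent.edge, hl, hl.le]
  · have hη : e = e' := by cases b <;> exact hη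
    subst hη
    simp [Tangent.pos, Tangent.edge, h0, h0.le, h1, h1.le]

/-- A function in `PL(Γ)` has an outgoing slope along every tangent vector. -/
theorem exists_hasSlope {Γ : MetricGraph V E} {f : Γ.Point → ℝ} (hf : f ∈ Γ.PL) {x : Γ.Point}
    (η : Γ.Tangent x) : ∃ s, HasSlope f η s := by
  obtain ⟨B, hB⟩ := hf η.edge
  obtain ⟨p0, p1, pf, pb⟩ := η.pos_bounds
  have hx := η.edgePoint_pos
  have hfin : (B : Set ℝ).Finite := B.finite_toSet
  cases hb : η.forward
  · have pb := pb hb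
    have hev : ∀ᶠ a in nhdsWithin η.pos (Set.Iio η.pos), 0 ≤ a ∧ a < η.pos ∧
        ∀ t ∈ Set.Ioo a η.pos, t ∉ B := by
      have h1 : ((B : Set ℝ) \ {η.pos})ᶜ ∈ nhds η.pos :=
        (hfin.subset Set.sdiff_subset).isClosed.isOpen_compl.mem_nhds (by simp)
      obtain ⟨l, hl, hlB⟩ := exists_Ioc_subset_of_mem_nhds h1 ⟨0, pb⟩
      filter_upwards [Ioo_mem_nhdsLT (max_lt hl pb)] with a ha
      refine ⟨(le_max_right l 0).trans ha.1.le, ha.2, fun t ht htB => ?_⟩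
      exact hlB ⟨((le_max_left l 0).trans_lt ha.1).trans ht.1, ht.2.le⟩ ⟨htB, ht.2.ne⟩
    obtain ⟨a, ha0, hap, haB⟩ := hev.exists
    obtain ⟨s, hs⟩ := hB a η.pos ha0 hap p1 haB
    refine ⟨-s, η.pos - a, by linarith, fun h hh => ?_⟩
    have e1 := hs (η.pos - h) ⟨by linarith [hh.2], by linarith [hh.1]⟩
    have e2 := hs η.pos ⟨hap.le, le_rfl⟩
    rw [hx] at e2
    simp only [Tangent.step, hb, Bool.false_eq_true, if_false]
    rw [e1, e2]; push_cast; ring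
  · have pf := pf hb
    have hev : ∀ᶠ b in nhdsWithin η.pos (Set.Ioi η.pos), b ≤ Γ.len η.edge ∧ η.pos < b ∧
        ∀ t ∈ Set.Ioo η.pos b, t ∉ B := by
      have h1 : ((B : Set ℝ) \ {η.pos})ᶜ ∈ nhds η.pos :=
        (hfin.subset Set.sdiff_subset).isClosed.isOpen_compl.mem_nhds (by simp)
      obtain ⟨u, hu, huB⟩ := exists_Ico_subset_of_mem_nhds h1 ⟨Γ.len η.edge, pf⟩
      filter_upwards [Ioo_mem_nhdsGT (lt_min hu pf)] with b hb'
      refine ⟨hb'.2.le.trans (min_le_right u _), hb'.1, fun t ht htB => ?_⟩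
      exact huB ⟨ht.1.le, (ht.2.trans hb'.2).trans_le (min_le_left u _)⟩ ⟨htB, ht.1.ne'⟩
    obtain ⟨b, hbl, hpb, hbB⟩ := hev.exists
    obtain ⟨s, hs⟩ := hB η.pos b p0 hpb hbl hbB
    refine ⟨s, b - η.pos, by linarith, fun h hh => ?_⟩
    have e1 := hs (η.pos + h) ⟨by linarith [hh.1], by linarith [hh.2]⟩
    rw [hx] at e1
    simp only [Tangent.step, hb, if_true]
    rw [e1]; ring

/-- Divisors: finitely supported formal sums of points with integer coefficients. -/
abbrev Divisor (Γ : MetricGraph V E) := Γ.Point →₀ ℤ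

def Divisor.degree {Γ : MetricGraph V E} (D : Γ.Divisor) : ℤ := Finsupp.sum D fun _ n => n

/-- The order of vanishing `ord_x(f)`, i.e. the coefficient of `div(f)` at `x`. -/
noncomputable def ord {Γ : MetricGraph V E} [Fintype E] (f : Γ.Point → ℝ) (x : Γ.Point) : ℤ :=
  -∑ η : Γ.Tangent x, slope f η

/-- The complete linear series `R(D)`. -/
def completeSeries {Γ : MetricGraph V E} [Fintype E] (D : Γ.Divisor) : Set (Γ.Point → ℝ) :=
  {f | f ∈ Γ.PL ∧ ∀ x, 0 ≤ D x + ord f x}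

/-- The tropical linear combination `min_i (f_i + a_i)` of `n + 1` functions. -/
noncomputable def tropComb {Γ : MetricGraph V E} {n : ℕ} (f : Fin (n + 1) → Γ.Point → ℝ)
    (a : Fin (n + 1) → ℝ) : Γ.Point → ℝ :=
  fun x => Finset.univ.inf' Finset.univ_nonempty fun i => f i x + a i

def IsTropicalSubmodule {Γ : MetricGraph V E} (M : Set (Γ.Point → ℝ)) : Prop :=
  ∀ (n : ℕ) (f : Fin (n + 1) → Γ.Point → ℝ) (a : Fin (n + 1) → ℝ),
    (∀ i, f i ∈ M) → tropComb f a ∈ M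

/-- The set `⟨G⟩` of all tropical linear combinations of functions in `G`. -/
def tropSpan {Γ : MetricGraph V E} (G : Set (Γ.Point → ℝ)) : Set (Γ.Point → ℝ) :=
  {θ | ∃ (n : ℕ) (f : Fin (n + 1) → Γ.Point → ℝ) (a : Fin (n + 1) → ℝ),
    (∀ i, f i ∈ G) ∧ θ = tropComb f a}

def FinitelyGenerated {Γ : MetricGraph V E} (M : Set (Γ.Point → ℝ)) : Prop :=
  ∃ G : Set (Γ.Point → ℝ), G.Finite ∧ M = tropSpan G

/-- The functions `f_1, …, f_n` are tropically dependent: for some real `a_i`, omitting any one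
of the terms `f_i + a_i` does not change the minimum of these terms at any point. -/
def TropicallyDependent {Γ : MetricGraph V E} {n : ℕ} (f : Fin n → Γ.Point → ℝ) : Prop :=
  ∃ a : Fin n → ℝ, ∀ i x, ∃ j, j ≠ i ∧ ∀ k, f j x + a j ≤ f k x + a k

/-- Every set of `m` functions in `M` is tropically dependent. -/
def EverySetDependent {Γ : MetricGraph V E} (m : ℕ) (M : Set (Γ.Point → ℝ)) : Prop :=
  ∀ f : Fin m → Γ.Point → ℝ, Function.Injective f → (∀ i, f i ∈ M) → TropicallyDependent f

/-- The Baker–Norine rank property `div(f) + D ≥ F`. -/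
def BakerNorineRank {Γ : MetricGraph V E} [Fintype E] (D F : Γ.Divisor) (f : Γ.Point → ℝ) :
    Prop :=
  ∀ x, F x ≤ ord f x + D x

/-- `(D, M)` is a tropical linear series of rank `r`. -/
structure IsTropicalLinearSeries {Γ : MetricGraph V E} [Fintype E] (r : ℕ) (D : Γ.Divisor)
    (M : Set (Γ.Point → ℝ)) : Prop where
  subset : M ⊆ completeSeries D
  submodule : IsTropicalSubmodule M
  finitelyGenerated : FinitelyGenerated M
  rank : ∀ F : Γ.Divisor, 0 ≤ F → Divisor.degree F = r → ∃ f ∈ M, BakerNorineRank D F f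
  dependent : EverySetDependent (r + 2) M

/-! ### Slope structures and combinatorial limit linear series -/

/-- An `r`-slope structure on `(Γ, W)`.  The arrays are indexed by the tangent vectors themselves
instead of by the numbers `1, …, val(x)`, so no ordering of the tangent vectors is recorded.

The fields `opposite_segment` and `opposite_point` say that on each component of `Γ ∖ W` the set `S^η` is the same for all
tangent vectors `η` of this component (those at its boundary pointing into it included) oriented in
the same direction, and is the opposite one for the other direction: `opposite_segment` expresses
this along a segment of an edge with no point of `W` in its interior, and `opposite_point` passes
from one side of a point of `Γ ∖ W`, possibly a vertex of the model of valence 2, to the other.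
In both, `η` and `ξ` have opposite directions in a component. -/
structure SlopeStructure (Γ : MetricGraph V E) [Fintype E] (W : Set Γ.Point) (r : ℕ) where
  finite : W.Finite
  mem_of_valence_ne : ∀ x, Γ.valence x ≠ 2 → x ∈ W
  /-- The slopes `s_0^η < ⋯ < s_r^η`. -/
  S : (x : Γ.Point) → Γ.Tangent x → Fin (r + 1) → ℤ
  strictMono : ∀ x η, StrictMono (S x η)
  /-- The permutation array at each point. -/
  P : (x : Γ.Point) → DotArray (Γ.Tangent x) r
  isPermutationArray : ∀ x, (P x).IsPermutationArray
  opposite_segment : ∀ (x y : Γ.Point) (η : Γ.Tangent x) (ξ : Γ.Tangent y), η.edge = ξ.edge →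
    η.forward = true → ξ.forward = false → η.pos < ξ.pos →
    (∀ t ∈ Set.Ioo η.pos ξ.pos, Γ.edgePoint η.edge t ∉ W) →
    ∀ i, S x η i + S y ξ i.rev = 0
  opposite_point : ∀ x, x ∉ W → ∀ η ξ : Γ.Tangent x, η ≠ ξ → ∀ i, S x η i + S x ξ i.rev = 0
  standard : ∀ x, x ∉ W → P x = DotArray.standard (Γ.Tangent x) r

namespace SlopeStructure

variable {Γ : MetricGraph V E} [Fintype E] {W : Set Γ.Point} {r : ℕ}

/-- The vector `∂_x(f)` of the positions of the slopes of `f` at `x` in the sets `S^η`. -/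
noncomputable def jump (𝔖 : SlopeStructure Γ W r) (f : Γ.Point → ℝ) (x : Γ.Point) :
    Γ.Tangent x → Fin (r + 1) :=
  fun η => Function.invFun (𝔖.S x η) (slope f η)

/-- The set `R(𝔖)` of the functions in `PL(Γ)` compatible with `𝔖`. -/
def compatible (𝔖 : SlopeStructure Γ W r) : Set (Γ.Point → ℝ) :=
  {f | f ∈ Γ.PL ∧ (∀ x (η : Γ.Tangent x), slope f η ∈ Set.range (𝔖.S x η)) ∧
    ∀ x, 𝔖.jump f x ∈ (𝔖.P x).redundantClosure}

/-- The rank `ρ_x(f)` of a compatible function at `x`. -/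
noncomputable def rankAt (𝔖 : SlopeStructure Γ W r) (f : Γ.Point → ℝ) (x : Γ.Point) : ℤ :=
  (𝔖.P x).rankArray (𝔖.jump f x)

/-- The local rank property for `F`. -/
def LocalRank (𝔖 : SlopeStructure Γ W r) (F : Γ.Divisor) (f : Γ.Point → ℝ) : Prop :=
  ∀ x, F x ≤ 𝔖.rankAt f x

end SlopeStructure

/-- `M` is closed in `PL(Γ)` for the topology of the sup norm. -/
def IsSupClosed {Γ : MetricGraph V E} (M : Set (Γ.Point → ℝ)) : Prop :=
  ∀ f ∈ Γ.PL, (∀ ε > 0, ∃ g ∈ M, ∀ x, |f x - g x| ≤ ε) → f ∈ M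

/-- The tropical submodule `M ⊆ R(D)` is admissible of rank `r`. -/
def IsAdmissible {Γ : MetricGraph V E} [Fintype E] (r : ℕ) (D : Γ.Divisor)
    (M : Set (Γ.Point → ℝ)) : Prop :=
  IsSupClosed M ∧ ∃ (W : Set Γ.Point) (𝔖 : SlopeStructure Γ W r),
    M ⊆ completeSeries D ∩ 𝔖.compatible ∧
    ∀ F : Γ.Divisor, 0 ≤ F → Divisor.degree F = r →
      ∃ f ∈ M, BakerNorineRank D F f ∧ 𝔖.LocalRank F f

/-- `(D, M)` is a combinatorial limit linear series of rank `r`. -/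
structure IsCombinatorialLimitLinearSeries {Γ : MetricGraph V E} [Fintype E] (r : ℕ)
    (D : Γ.Divisor) (M : Set (Γ.Point → ℝ)) : Prop where
  subset : M ⊆ completeSeries D
  submodule : IsTropicalSubmodule M
  finitelyGenerated : FinitelyGenerated M
  admissible : IsAdmissible r D M
  dependent : EverySetDependent (r + 2) M

end MetricGraph

/-! A combinatorial limit linear series is a tropical linear series by forgetting the slope
structure; the content is to construct that structure. Finite generation reduces everything to the
slopes of finitely many generators `g l` at each point `x`, because a minimum of the `g l + c l`
has, along each tangent vector, the least slope of the generators active at `x`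
(`exists_slope_minComb_eq`).

Dependence bounds these slopes from above: any `r + 2` generators contain a nonempty subset
attaining its least slope twice in every direction (`exists_isCircuit`). Rank bounds them from
below: prescribed points close to `x` force a concave function to bend, and each bend needs a
further slope (`IsChart.exists_chain`). Hence there are exactly `r + 1` slopes along each tangent
vector.

On an interval or a loop there are at most two tangent vectors `η`, `ξ` at `x`, and the heart of the
proof is how their slopes are matched. Raise lower bounds `(a, b)` on the two slopes by unit steps,
counting a step if it loses a generator. A counted step costs at most one point of rank, so after `c
≤ r` of them generators with `r - c + 1` distinct slopes remain (`flagRank_of_latticePath`).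
Conversely, one lost generator per counted step gives an independent set, still independent together
with remaining generators of distinct slopes (`LatticePath.add_card_le`). Comparing two paths with
the same end shows that the count depends on the end only. Going round a unit square, a generator
with the largest `ξ`-slope for its `η`-slope then also has the largest `η`-slope for its `ξ`-slope
(`exists_isDot`). Such slope vectors are the dots: every slope occurs in exactly one, so they form a
permutation array.

The slope vector of any minimum is a meet of dots sharing a coordinate with it, which is
compatibility. For the local rank, spread `F` into distinct nearby points and pass to a limit of the
resulting functions: at least `F x + 1` generators of distinct slopes become active at `x`, and the
dots above them give the rank (`exists_minComb_dominated`). -/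

namespace DotArray

/-! ### Permutation arrays with bijective coordinates -/

variable {ι : Type*} {r : ℕ}

theorem hasRank_of_injOn {P : DotArray ι r} (h : ∀ i, Set.InjOn (fun y => y i) P) :
    P.HasRank ((P.ncard : ℤ) - 1) := fun i => by
  rw [axisRank, (h i).ncard_image]

theorem injOn_of_existsUnique {P : DotArray ι r} (h : ∀ i a, ∃! y, y ∈ P ∧ y i = a) (i : ι) :
    Set.InjOn (fun y : ι → Fin (r + 1) => y i) P := fun y hy _ hz hyz =>
  (h i (y i)).unique ⟨hy, rfl⟩ ⟨hz, hyz.symm⟩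

/-- Distinct dots differ in every coordinate, so each axis of a principal subarray just counts its
dots. -/
theorem hasRank_principal {P : DotArray ι r} (h : ∀ i a, ∃! y, y ∈ P ∧ y i = a)
    (x : ι → Fin (r + 1)) : (P.principal x).HasRank (((P.principal x).ncard : ℤ) - 1) :=
  hasRank_of_injOn fun i => (injOn_of_existsUnique h i).mono fun _ hy => hy.1

/-- A dot array each of whose coordinates is a bijection onto `[r]` is a permutation array. -/
theorem isPermutationArray_of_existsUnique {P : DotArray ι r}
    (h : ∀ i a, ∃! y, y ∈ P ∧ y i = a) : P.IsPermutationArray := by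
  refine ⟨fun x => ⟨_, hasRank_principal h x⟩, fun i => ?_, fun x hx ⟨H, hHP, hc, _, hs⟩ => ?_⟩
  · have : (fun x : ι → Fin (r + 1) => x i) '' P = Set.univ := by
      refine Set.eq_univ_of_forall fun a => ?_
      obtain ⟨y, ⟨hy, hya⟩, _⟩ := h i a
      exact ⟨y, hy, hya⟩
    rw [axisRank, this, Set.ncard_univ]
    simp
  · have : H ⊆ {x} := fun y hy => by
      obtain ⟨i, hi⟩ := hs y hy
      exact Finset.mem_singleton.2 ((h i (x i)).unique ⟨hHP hy, hi⟩ ⟨hx, rfl⟩)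
    have := Finset.card_le_card this
    simp at this
    omega

/-- The dots chosen for the various coordinates have meet `y`. If they all coincide, `y` is itself a
dot; otherwise they witness redundancy. -/
theorem mem_redundantClosure_of_forall_exists [Finite ι] [Nonempty ι] {P : DotArray ι r}
    {y : ι → Fin (r + 1)} (h : ∀ i, ∃ d ∈ P, d i = y i ∧ y ≤ d) : y ∈ P.redundantClosure := by
  classical
  have := Fintype.ofFinite ι
  choose d hdP hd hyd using h
  by_cases hc : 2 ≤ (Finset.univ.image d).card
  · refine Or.inr ⟨Finset.univ.image d, ?_, hc, ⟨?_, fun z hz i => ?_⟩, ?_⟩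
    · intro z hz
      obtain ⟨i, _, rfl⟩ := Finset.mem_image.1 hz
      exact hdP i
    · intro z hz
      obtain ⟨i, _, rfl⟩ := Finset.mem_image.1 hz
      exact hyd i
    · have := hz (Finset.mem_coe.2 (Finset.mem_image_of_mem d (Finset.mem_univ i))) i
      rwa [hd] at this
    · intro z hz
      obtain ⟨i, _, rfl⟩ := Finset.mem_image.1 hz
      exact ⟨i, hd i⟩
  · obtain ⟨i₀⟩ := (inferInstance : Nonempty ι)
    have h1 : (Finset.univ.image d).card ≤ 1 := by omega
    have : y = d i₀ := funext fun i => by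
      rw [← hd i]
      exact congrFun (Finset.card_le_one.1 h1 _ (Finset.mem_image_of_mem d (Finset.mem_univ i)) _
        (Finset.mem_image_of_mem d (Finset.mem_univ i₀))) i
    exact Or.inl (this ▸ hdP i₀)

theorem le_rankArray [Finite ι] [Nonempty ι] {P : DotArray ι r}
    (h : ∀ i a, ∃! y, y ∈ P ∧ y i = a) {x : ι → Fin (r + 1)} {m : ℤ}
    (T : Finset (ι → Fin (r + 1))) (hT : ∀ y ∈ T, y ∈ P ∧ x ≤ y) (hm : m + 1 ≤ T.card) :
    m ≤ P.rankArray x := by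
  rw [rankArray_eq (hasRank_principal h x)]
  have : T.card ≤ (P.principal x).ncard := by
    rw [← Set.ncard_coe_finset]
    exact Set.ncard_le_ncard (fun y hy => hT y hy) (Set.toFinite _)
  have : (T.card : ℤ) ≤ (P.principal x).ncard := by exact_mod_cast this
  linarith

end DotArray

/-! ### Boundedness of piecewise linear functions and tangent vectors near a point -/

namespace MetricGraph

variable {V E : Type*} {Γ : MetricGraph V E}

theorem edgePoint_of_mem_Ioo {e : E} {t : ℝ} (h0 : 0 < t) (h1 : t < Γ.len e) :
    Γ.edgePoint e t = .inner e t h0 h1 := by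
  simp [edgePoint, h0, h1]

/-- Induction on the number of break points inside the segment: cut at one of them, and use
affineness when none is left. -/
theorem bounded_segment {f : Γ.Point → ℝ} {e : E} {B : Finset ℝ}
    (hB : ∀ a b, 0 ≤ a → a < b → b ≤ Γ.len e → (∀ t ∈ Set.Ioo a b, t ∉ B) →
      ∃ s : ℤ, ∀ t ∈ Set.Icc a b, f (Γ.edgePoint e t) = f (Γ.edgePoint e a) + s * (t - a)) :
    ∀ (n : ℕ) (a b : ℝ), 0 ≤ a → a < b → b ≤ Γ.len e →
      (B.filter fun t => t ∈ Set.Ioo a b).card ≤ n →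
      ∃ K, ∀ t ∈ Set.Icc a b, |f (Γ.edgePoint e t)| ≤ K := by
  intro n
  induction n with
  | zero =>
    intro a b ha hab hb hn
    obtain ⟨s, hs⟩ := hB a b ha hab hb fun t ht htB => by
      exact hn.not_gt (Finset.card_pos.2 ⟨t, Finset.mem_filter.2 ⟨htB, ht⟩⟩)
    refine ⟨|f (Γ.edgePoint e a)| + |(s : ℝ)| * (b - a), fun t ht => ?_⟩
    rw [hs t ht]
    refine (abs_add_le _ _).trans ?_
    rw [abs_mul, abs_of_nonneg (sub_nonneg.2 ht.1)]
    gcongr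
    exact ht.2
  | succ n ih =>
    intro a b ha hab hb hn
    by_cases hex : ∃ t ∈ B, t ∈ Set.Ioo a b
    · obtain ⟨t, htB, ht⟩ := hex
      have key : ∀ a' b', a ≤ a' → b' ≤ b → t ∉ Set.Ioo a' b' →
          (B.filter fun t => t ∈ Set.Ioo a' b').card ≤ n := by
        intro a' b' ha' hb' ht'
        have : (B.filter fun t => t ∈ Set.Ioo a' b').card <
            (B.filter fun t => t ∈ Set.Ioo a b).card := by
          refine Finset.card_lt_card (Finset.ssubset_iff_subset_ne.2 ⟨fun u hu => ?_, fun h => ?_⟩)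
          · simp only [Finset.mem_filter, Set.mem_Ioo] at hu ⊢
            exact ⟨hu.1, ha'.trans_lt hu.2.1, hu.2.2.trans_le hb'⟩
          · have : t ∈ B.filter fun t => t ∈ Set.Ioo a b := Finset.mem_filter.2 ⟨htB, ht⟩
            rw [← h] at this
            exact ht' (Finset.mem_filter.1 this).2
        omega
      obtain ⟨K₁, h₁⟩ := ih a t ha ht.1 (ht.2.le.trans hb)
        (key a t le_rfl ht.2.le fun h => lt_irrefl _ h.2)
      obtain ⟨K₂, h₂⟩ := ih t b (ha.trans ht.1.le) ht.2 hb
        (key t b ht.1.le le_rfl fun h => lt_irrefl _ h.1)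
      refine ⟨max K₁ K₂, fun u hu => ?_⟩
      rcases le_total u t with h | h
      · exact (h₁ u ⟨hu.1, h⟩).trans (le_max_left _ _)
      · exact (h₂ u ⟨h, hu.2⟩).trans (le_max_right _ _)
    · refine ih a b ha hab hb ?_
      rw [Finset.card_eq_zero.2 (Finset.filter_eq_empty_iff.2 fun t ht h => hex ⟨t, ht, h⟩)]
      exact n.zero_le

theorem bounded_of_mem_PL [Finite V] [Finite E] {f : Γ.Point → ℝ} (hf : f ∈ Γ.PL) :
    ∃ K, ∀ x, |f x| ≤ K := by
  have := Fintype.ofFinite V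
  have := Fintype.ofFinite E
  have h : ∀ e, ∃ K, ∀ t ∈ Set.Icc 0 (Γ.len e), |f (Γ.edgePoint e t)| ≤ K := fun e => by
    obtain ⟨B, hB⟩ := hf e
    exact bounded_segment hB _ 0 _ le_rfl (Γ.len_pos e) le_rfl le_rfl
  choose K hK using h
  have hK0 : ∀ e, 0 ≤ K e := fun e =>
    (abs_nonneg _).trans (hK e 0 ⟨le_rfl, (Γ.len_pos e).le⟩)
  refine ⟨∑ v, |f (.vertex v)| + ∑ e, K e, fun x => ?_⟩
  rcases x with v | ⟨e, t, h0, h1⟩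
  · have h2 := Finset.single_le_sum (f := fun v => |f (.vertex v)|) (fun v _ => abs_nonneg _)
      (Finset.mem_univ v)
    have h3 := Finset.sum_nonneg fun e (_ : e ∈ Finset.univ) => hK0 e
    linarith
  · have h2 := Finset.single_le_sum (f := K) (fun e _ => hK0 e) (Finset.mem_univ e)
    have h3 := Finset.sum_nonneg fun v (_ : v ∈ Finset.univ) => abs_nonneg (f (.vertex v))
    have h4 := hK e t ⟨h0.le, h1.le⟩
    rw [edgePoint_of_mem_Ioo h0 h1] at h4
    linarith

theorem hasSlope_slope {f : Γ.Point → ℝ} (hf : f ∈ Γ.PL) {x : Γ.Point} (η : Γ.Tangent x) :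
    HasSlope f η (slope f η) := by
  obtain ⟨s, hs⟩ := exists_hasSlope hf η
  rwa [hs.slope_eq]

theorem Tangent.step_zero {x : Γ.Point} (η : Γ.Tangent x) : η.step 0 = x := by
  simp [Tangent.step, η.edgePoint_pos]

theorem slope_add_const {f : Γ.Point → ℝ} (hf : f ∈ Γ.PL) (k : ℝ) {x : Γ.Point}
    (η : Γ.Tangent x) : slope (fun y => f y + k) η = slope f η := by
  obtain ⟨ε, hε, h⟩ := hasSlope_slope hf η
  exact HasSlope.slope_eq ⟨ε, hε, fun t ht => by simp only [h t ht]; ring⟩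

/-- The two tangent vectors at an interior point of an edge. -/
theorem exists_tangents_of_eq_inner {y : Γ.Point} {e : E} {t : ℝ} {h0 : 0 < t} {h1 : t < Γ.len e}
    (hy : y = .inner e t h0 h1) : ∃ ζ ζ' : Γ.Tangent y, ζ ≠ ζ' ∧ (∀ ξ, ξ = ζ ∨ ξ = ζ') ∧
      (∀ k, ζ.step k = Γ.edgePoint e (t + k)) ∧ ∀ k, ζ'.step k = Γ.edgePoint e (t - k) := by
  subst hy
  refine ⟨⟨(e, true), rfl⟩, ⟨(e, false), rfl⟩, fun h => ?_, fun ξ => ?_, fun k => ?_, fun k => ?_⟩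
  · have := congrArg Tangent.forward h
    simp [Tangent.forward] at this
  · obtain ⟨⟨e', b⟩, hξ⟩ := ξ
    cases b
    · right
      have : e' = e := hξ
      subst this; rfl
    · left
      have : e' = e := hξ
      subst this; rfl
  · simp [Tangent.step, Tangent.forward, Tangent.edge, Tangent.pos]
  · simp [Tangent.step, Tangent.forward, Tangent.edge, Tangent.pos]

/-- Points close to `x` in the direction of `η` have two tangent vectors, the first pointing in the
direction of `η`. -/
theorem Tangent.exists_neighbors {x : Γ.Point} (η : Γ.Tangent x) : ∃ ε > 0,
    Set.InjOn η.step (Set.Ioo 0 ε) ∧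
    ∀ h ∈ Set.Ioo 0 ε, ∃ ζ ζ' : Γ.Tangent (η.step h), ζ ≠ ζ' ∧ (∀ ξ, ξ = ζ ∨ ξ = ζ') ∧
      (∀ k, ζ.step k = η.step (h + k)) ∧ ∀ k, ζ'.step k = η.step (h - k) := by
  obtain ⟨p0, p1, pf, pb⟩ := η.pos_bounds
  cases hb : η.forward
  · have hstep : ∀ h, η.step h = Γ.edgePoint η.edge (η.pos - h) := fun h => by
      simp [Tangent.step, hb]
    have hin : ∀ h (hh : h ∈ Set.Ioo 0 η.pos), η.step h =
        .inner η.edge (η.pos - h) (by linarith [hh.2]) (by linarith [hh.1]) := fun h hh => by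
      rw [hstep, edgePoint_of_mem_Ioo]
    refine ⟨η.pos, pb hb, fun h hh k hk hhk => ?_, fun h hh => ?_⟩
    · rw [hin h hh, hin k hk] at hhk
      have := (Point.inner.inj hhk).2
      linarith
    · obtain ⟨ζ, ζ', h1, h2, h3, h4⟩ := exists_tangents_of_eq_inner (hin h hh)
      refine ⟨ζ', ζ, h1.symm, fun ξ => (h2 ξ).symm, fun k => ?_, fun k => ?_⟩
      · rw [h4, hstep]; ring_nf
      · rw [h3, hstep]; ring_nf
  · have hstep : ∀ h, η.step h = Γ.edgePoint η.edge (η.pos + h) := fun h => by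
      simp [Tangent.step, hb]
    have hin : ∀ h (hh : h ∈ Set.Ioo 0 (Γ.len η.edge - η.pos)), η.step h =
        .inner η.edge (η.pos + h) (by linarith [hh.1]) (by linarith [hh.2]) := fun h hh => by
      rw [hstep, edgePoint_of_mem_Ioo]
    refine ⟨Γ.len η.edge - η.pos, by linarith [pf hb], fun h hh k hk hhk => ?_, fun h hh => ?_⟩
    · rw [hin h hh, hin k hk] at hhk
      have := (Point.inner.inj hhk).2
      linarith
    · obtain ⟨ζ, ζ', h1, h2, h3, h4⟩ := exists_tangents_of_eq_inner (hin h hh)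
      refine ⟨ζ, ζ', h1, h2, fun k => ?_, fun k => ?_⟩
      · rw [h3, hstep]; ring_nf
      · rw [h4, hstep]; ring_nf

/-! ### Intervals and loops have at most two directions at each point -/

/-- Every point has one or two tangent vectors. -/
def ThinAt (Γ : MetricGraph V E) (x : Γ.Point) : Prop :=
  ∃ η ξ : Γ.Tangent x, ∀ ζ, ζ = η ∨ ζ = ξ

/-- Cut each edge into a half at `p e` and a half at `q e`. By injectivity a vertex carries at most
one half of each kind, and by `hv` at least one half. -/
theorem thinAt_of_halves {p q : E → V} (hp : Function.Injective p) (hq : Function.Injective q)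
    (hs : ∀ e, s(Γ.src e, Γ.tgt e) = s(p e, q e)) (hv : ∀ v, (∃ e, p e = v) ∨ ∃ e, q e = v)
    (x : Γ.Point) : Γ.ThinAt x := by
  rcases x with v | ⟨e, t, h0, h1⟩
  · classical
    -- The model may orient an edge either way; `o e` records whether it runs from `p e` to `q e`.
    let o : E → Bool := fun e => decide (Γ.src e = p e ∧ Γ.tgt e = q e)
    have ho : ∀ e, o e = false → Γ.src e = q e ∧ Γ.tgt e = p e := fun e he => by
      rcases Sym2.eq_iff.1 (hs e) with h | h
      · exact absurd h (by simpa [o] using he)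
      · exact h
    have ho' : ∀ e, o e = true → Γ.src e = p e ∧ Γ.tgt e = q e := fun e he => by
      simpa [o] using he
    have hpe : ∀ e, Γ.IsDirection (.vertex (p e)) (e, o e) := fun e => by
      cases h : o e
      · exact (ho e h).2
      · exact (ho' e h).1
    have hqe : ∀ e, Γ.IsDirection (.vertex (q e)) (e, !(o e)) := fun e => by
      cases h : o e
      · exact (ho e h).1
      · exact (ho' e h).2
    have hd : ∀ ζ : Γ.Tangent (.vertex v), (p ζ.1.1 = v ∧ ζ.1.2 = o ζ.1.1) ∨
        (q ζ.1.1 = v ∧ ζ.1.2 = !(o ζ.1.1)) := by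
      rintro ⟨⟨e, b⟩, hζ⟩
      cases b <;> cases h : o e <;> simp only [IsDirection] at hζ <;>
        first
        | (have := ho e h; rw [this.1] at hζ; simp [hζ])
        | (have := ho e h; rw [this.2] at hζ; simp [hζ])
        | (have := ho' e h; rw [this.1] at hζ; simp [hζ])
        | (have := ho' e h; rw [this.2] at hζ; simp [hζ])
    have hpu : ∀ ζ ξ : Γ.Tangent (.vertex v), p ζ.1.1 = v ∧ ζ.1.2 = o ζ.1.1 →
        p ξ.1.1 = v ∧ ξ.1.2 = o ξ.1.1 → ζ = ξ := by
      rintro ⟨⟨e, b⟩, hζ⟩ ⟨⟨e', b'⟩, hξ⟩ h h'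
      have he : e = e' := hp (h.1.trans h'.1.symm)
      subst he
      have : b = b' := h.2.trans h'.2.symm
      subst this; rfl
    have hqu : ∀ ζ ξ : Γ.Tangent (.vertex v), q ζ.1.1 = v ∧ ζ.1.2 = !(o ζ.1.1) →
        q ξ.1.1 = v ∧ ξ.1.2 = !(o ξ.1.1) → ζ = ξ := by
      rintro ⟨⟨e, b⟩, hζ⟩ ⟨⟨e', b'⟩, hξ⟩ h h'
      have he : e = e' := hq (h.1.trans h'.1.symm)
      subst he
      have : b = b' := h.2.trans h'.2.symm
      subst this; rfl
    have hne : ∃ ζ₀ : Γ.Tangent (.vertex v), True := by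
      rcases hv v with ⟨e, rfl⟩ | ⟨e, rfl⟩
      · exact ⟨⟨_, hpe e⟩, trivial⟩
      · exact ⟨⟨_, hqe e⟩, trivial⟩
    obtain ⟨ζ₀, -⟩ := hne
    by_cases h1 : ∃ η : Γ.Tangent (.vertex v), p η.1.1 = v ∧ η.1.2 = o η.1.1
    · obtain ⟨η, hη⟩ := h1
      by_cases h2 : ∃ ξ : Γ.Tangent (.vertex v), q ξ.1.1 = v ∧ ξ.1.2 = !(o ξ.1.1)
      · obtain ⟨ξ, hξ⟩ := h2
        exact ⟨η, ξ, fun ζ => (hd ζ).imp (fun h => hpu _ _ h hη) fun h => hqu _ _ h hξ⟩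
      · exact ⟨η, η, fun ζ => (hd ζ).imp (fun h => hpu _ _ h hη) fun h => absurd ⟨ζ, h⟩ h2⟩
    · have hq0 : ∀ ζ : Γ.Tangent (.vertex v), q ζ.1.1 = v ∧ ζ.1.2 = !(o ζ.1.1) := fun ζ =>
        (hd ζ).resolve_left fun h => h1 ⟨ζ, h⟩
      exact ⟨ζ₀, ζ₀, fun ζ => Or.inl (hqu _ _ (hq0 ζ) (hq0 ζ₀))⟩
  · obtain ⟨ζ, ζ', -, h, -, -⟩ := exists_tangents_of_eq_inner (Γ := Γ) (y := .inner e t h0 h1) rfl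
    exact ⟨ζ, ζ', h⟩

theorem thinAt_of_isInterval_or_isLoop (hΓ : Γ.IsInterval ∨ Γ.IsLoop) (x : Γ.Point) :
    Γ.ThinAt x := by
  rcases hΓ with ⟨n, v, e, h⟩ | ⟨n, v, e, h⟩
  · refine thinAt_of_halves (p := fun i => v (e.symm i).castSucc)
      (q := fun i => v (e.symm i).succ) ?_ ?_ (fun i => ?_) (fun w => ?_) x
    · exact v.injective.comp ((Fin.castSucc_injective _).comp e.symm.injective)
    · exact v.injective.comp ((Fin.succ_injective _).comp e.symm.injective)
    · simpa using h (e.symm i)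
    · rcases Fin.eq_castSucc_or_eq_last (v.symm w) with ⟨i, hi⟩ | hi
      · exact Or.inl ⟨e i, by simp [← hi]⟩
      · exact Or.inr ⟨e (Fin.last n), by simp [← hi]⟩
  · refine thinAt_of_halves (p := fun i => v (e.symm i))
      (q := fun i => v (e.symm i + 1)) ?_ ?_ (fun i => ?_) (fun w => ?_) x
    · exact v.injective.comp e.symm.injective
    · exact v.injective.comp ((add_left_injective _).comp e.symm.injective)
    · simpa using h (e.symm i)
    · exact Or.inl ⟨e (v.symm w), by simp⟩

theorem nonempty_point_of_isInterval_or_isLoop (hΓ : Γ.IsInterval ∨ Γ.IsLoop) :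
    Nonempty Γ.Point := by
  rcases hΓ with ⟨n, v, _⟩ | ⟨n, v, _⟩
  · exact ⟨.vertex (v 0)⟩
  · exact ⟨.vertex (v 0)⟩

end MetricGraph

/-! ### Minima of finitely many functions near a point -/

namespace MetricGraph

variable {V E : Type*} {Γ : MetricGraph V E}

section MinComb

variable {L : Type*} {g : L → Γ.Point → ℝ} {c : L → ℝ}

/-- The minimum of the functions `g l + c l` over all indices. -/
noncomputable def minComb [Fintype L] [Nonempty L] (g : L → Γ.Point → ℝ) (c : L → ℝ) :
    Γ.Point → ℝ :=
  fun x => Finset.univ.inf' Finset.univ_nonempty fun l => g l x + c l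

/-- The minimum of the `g k + c k` at `x` is attained by the index `l`. -/
def ActiveAt (g : L → Γ.Point → ℝ) (c : L → ℝ) (x : Γ.Point) (l : L) : Prop :=
  ∀ k, g l x + c l ≤ g k x + c k

theorem minComb_le [Fintype L] [Nonempty L] (x : Γ.Point) (l : L) :
    minComb g c x ≤ g l x + c l :=
  Finset.inf'_le _ (Finset.mem_univ l)

theorem ActiveAt.minComb_eq [Fintype L] [Nonempty L] {x : Γ.Point} {l : L}
    (h : ActiveAt g c x l) : minComb g c x = g l x + c l :=
  le_antisymm (minComb_le x l) (Finset.le_inf' _ _ fun k _ => h k)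

theorem ActiveAt.eq {x : Γ.Point} {l k : L} (hl : ActiveAt g c x l) (hk : ActiveAt g c x k) :
    g l x + c l = g k x + c k :=
  le_antisymm (hl k) (hk l)

theorem exists_activeAt [Finite L] [Nonempty L] (g : L → Γ.Point → ℝ) (c : L → ℝ)
    (x : Γ.Point) : ∃ l, ActiveAt g c x l :=
  Finite.exists_min fun l => g l x + c l

theorem exists_pos_forall_of_forall_exists_pos [Finite L] {p : L → ℝ → Prop}
    (h : ∀ l, ∃ ε > 0, ∀ t ∈ Set.Icc (0 : ℝ) ε, p l t) :
    ∃ ε > 0, ∀ l, ∀ t ∈ Set.Icc (0 : ℝ) ε, p l t := by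
  choose ε hε hp using h
  rcases isEmpty_or_nonempty L with hL | hL
  · exact ⟨1, one_pos, fun l => (hL.false l).elim⟩
  · obtain ⟨k, hk⟩ := Finite.exists_min ε
    exact ⟨ε k, hε k, fun l t ht => hp l t ⟨ht.1, ht.2.trans (hk l)⟩⟩

theorem exists_activeAt_slope_le [Finite L] [Nonempty L] (g : L → Γ.Point → ℝ) (c : L → ℝ)
    {x : Γ.Point} (η : Γ.Tangent x) :
    ∃ l, ActiveAt g c x l ∧ ∀ k, ActiveAt g c x k → slope (g l) η ≤ slope (g k) η := by
  have : Nonempty {l // ActiveAt g c x l} := (exists_activeAt g c x).elim fun l hl => ⟨⟨l, hl⟩⟩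
  obtain ⟨l, hl⟩ := Finite.exists_min fun l : {l // ActiveAt g c x l} => slope (g l) η
  exact ⟨l, l.2, fun k hk => hl ⟨k, hk⟩⟩

/-- An active function of minimal slope stays active for a short while. -/
theorem exists_pos_activeAt_step [Finite L] (hg : ∀ l, g l ∈ Γ.PL) {x : Γ.Point}
    {η : Γ.Tangent x} {l : L} (hl : ActiveAt g c x l)
    (hmin : ∀ k, ActiveAt g c x k → slope (g l) η ≤ slope (g k) η) :
    ∃ ε > 0, ∀ t ∈ Set.Icc (0 : ℝ) ε, ActiveAt g c (η.step t) l := by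
  have key : ∀ k, ∃ ε > 0, ∀ t ∈ Set.Icc (0 : ℝ) ε,
      g l (η.step t) + c l ≤ g k (η.step t) + c k := by
    intro k
    obtain ⟨ε₁, hε₁, h₁⟩ := hasSlope_slope (hg l) η
    obtain ⟨ε₂, hε₂, h₂⟩ := hasSlope_slope (hg k) η
    by_cases hk : ActiveAt g c x k
    · refine ⟨min ε₁ ε₂, lt_min hε₁ hε₂, fun t ht => ?_⟩
      rw [h₁ t ⟨ht.1, ht.2.trans (min_le_left _ _)⟩, h₂ t ⟨ht.1, ht.2.trans (min_le_right _ _)⟩]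
      have h3 : (slope (g l) η : ℝ) ≤ slope (g k) η := by exact_mod_cast hmin k hk
      have := mul_le_mul_of_nonneg_right h3 ht.1
      linarith [hl k]
    · have hlt : g l x + c l < g k x + c k := by
        refine lt_of_le_of_ne (hl k) fun h => hk fun m => ?_
        rw [← h]; exact hl m
      set d := g k x + c k - (g l x + c l) with hd
      -- The gap `d` at `x` shrinks at a rate less than `s`, so it persists up to distance `d / s`;
      -- the summand 1 keeps `s` positive.
      set s : ℝ := |(slope (g l) η : ℝ) - slope (g k) η| + 1 with hs
      have hs0 : 0 < s := by positivity
      have hd0 : 0 < d := by linarith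
      refine ⟨min (min ε₁ ε₂) (d / s), lt_min (lt_min hε₁ hε₂) (div_pos hd0 hs0), fun t ht => ?_⟩
      rw [h₁ t ⟨ht.1, ht.2.trans ((min_le_left _ _).trans (min_le_left _ _))⟩,
        h₂ t ⟨ht.1, ht.2.trans ((min_le_left _ _).trans (min_le_right _ _))⟩]
      have h3 : t * s ≤ d := (le_div_iff₀ hs0).1 (ht.2.trans (min_le_right _ _))
      have h4 := mul_le_mul_of_nonneg_right
        ((le_abs_self ((slope (g l) η : ℝ) - slope (g k) η)).trans (lt_add_one _).le) ht.1
      rw [← hs] at h4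
      linarith
  obtain ⟨ε, hε, h⟩ := exists_pos_forall_of_forall_exists_pos key
  exact ⟨ε, hε, fun t ht k => h k t ht⟩

theorem hasSlope_minComb [Fintype L] [Nonempty L] (hg : ∀ l, g l ∈ Γ.PL) {x : Γ.Point}
    {η : Γ.Tangent x} {l : L} (hl : ActiveAt g c x l)
    (hmin : ∀ k, ActiveAt g c x k → slope (g l) η ≤ slope (g k) η) :
    HasSlope (minComb g c) η (slope (g l) η) := by
  obtain ⟨ε₁, hε₁, h₁⟩ := exists_pos_activeAt_step hg hl hmin
  obtain ⟨ε₂, hε₂, h₂⟩ := hasSlope_slope (hg l) η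
  refine ⟨min ε₁ ε₂, lt_min hε₁ hε₂, fun t ht => ?_⟩
  rw [(h₁ t ⟨ht.1, ht.2.trans (min_le_left _ _)⟩).minComb_eq, hl.minComb_eq,
    h₂ t ⟨ht.1, ht.2.trans (min_le_right _ _)⟩]
  ring

/-- The slope of a minimum is the least slope of the active functions. -/
theorem exists_slope_minComb_eq [Fintype L] [Nonempty L] (hg : ∀ l, g l ∈ Γ.PL) (c : L → ℝ)
    {x : Γ.Point} (η : Γ.Tangent x) :
    ∃ l, ActiveAt g c x l ∧ slope (minComb g c) η = slope (g l) η ∧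
      ∀ k, ActiveAt g c x k → slope (minComb g c) η ≤ slope (g k) η := by
  obtain ⟨l, hl, hmin⟩ := exists_activeAt_slope_le g c η
  have := (hasSlope_minComb hg hl hmin).slope_eq
  exact ⟨l, hl, this, fun k hk => this ▸ hmin k hk⟩

/-- If at every point of a neighbourhood the minimum is attained twice, then so is the least slope
of the functions active at `x`. -/
theorem exists_ne_slope_eq [Finite L] [Nonempty L] (hg : ∀ l, g l ∈ Γ.PL)
    (hdep : ∀ l x, ∃ k, k ≠ l ∧ ActiveAt g c x k) {x : Γ.Point} (η : Γ.Tangent x) :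
    ∃ l k, ActiveAt g c x l ∧ ActiveAt g c x k ∧ l ≠ k ∧ slope (g l) η = slope (g k) η ∧
      ∀ m, ActiveAt g c x m → slope (g l) η ≤ slope (g m) η := by
  obtain ⟨l, hl, hmin⟩ := exists_activeAt_slope_le g c η
  obtain ⟨ε₁, hε₁, h₁⟩ := exists_pos_activeAt_step hg hl hmin
  obtain ⟨ε₂, hε₂, h₂⟩ := exists_pos_forall_of_forall_exists_pos fun l => hasSlope_slope (hg l) η
  set ε := min ε₁ ε₂
  have hε : 0 < ε := lt_min hε₁ hε₂
  have a₁ : ∀ t ∈ Set.Icc 0 ε, ActiveAt g c (η.step t) l := fun t ht =>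
    h₁ t ⟨ht.1, ht.2.trans (min_le_left _ _)⟩
  have a₂ : ∀ k, ∀ t ∈ Set.Icc 0 ε, g k (η.step t) = g k x + slope (g k) η * t := fun k t ht =>
    h₂ k t ⟨ht.1, ht.2.trans (min_le_right _ _)⟩
  -- The difference of the terms of `k` and `l` is affine on the segment, nonnegative at both ends
  -- and zero at the midpoint, hence identically zero.
  obtain ⟨k, hkl, hk⟩ := hdep l (η.step (ε / 2))
  have m : ε / 2 ∈ Set.Icc 0 ε := ⟨by linarith, by linarith⟩
  have m' : ε ∈ Set.Icc 0 ε := ⟨hε.le, le_rfl⟩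
  have e1 := hk.eq (a₁ _ m)
  have e2 := a₁ ε m' k
  have e3 := hl k
  rw [a₂ l _ m, a₂ k _ m] at e1
  rw [a₂ l _ m', a₂ k _ m'] at e2
  have e4 : g k x + c k = g l x + c l := by linarith
  have e5 : (slope (g l) η : ℝ) * ε = slope (g k) η * ε := by linarith
  refine ⟨l, k, hl, fun n => e4 ▸ hl n, hkl.symm, ?_, hmin⟩
  exact_mod_cast mul_right_cancel₀ hε.ne' e5

/-- `A` is a circuit for the functions `σ t`: each of them attains its minimum on `A` twice. -/
def IsCircuit {T : Type*} (σ : T → L → ℤ) (A : Finset L) : Prop :=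
  A.Nonempty ∧ ∀ t, ∃ i ∈ A, ∃ j ∈ A, i ≠ j ∧ σ t i = σ t j ∧ ∀ k ∈ A, σ t i ≤ σ t k

/-- Tropical dependence gives circuits for the slopes at each point. -/
theorem exists_isCircuit {r : ℕ} {M : Set (Γ.Point → ℝ)} (hM : EverySetDependent (r + 2) M)
    (hg : ∀ l, g l ∈ Γ.PL) (hgM : ∀ l, g l ∈ M) (hinj : Function.Injective g) (x : Γ.Point)
    {T : Finset L} (hT : r + 2 ≤ T.card) :
    ∃ A ⊆ T, IsCircuit (fun (ζ : Γ.Tangent x) l => slope (g l) ζ) A := by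
  classical
  obtain ⟨T', hT', hc⟩ := Finset.exists_subset_card_eq hT
  let e : Fin (r + 2) ≃ T' := (T'.equivFinOfCardEq hc).symm
  let u : Fin (r + 2) → L := fun i => e i
  have hu : Function.Injective u := Subtype.val_injective.comp e.injective
  obtain ⟨a, ha⟩ := hM (fun i => g (u i)) (hinj.comp hu) fun i => hgM _
  -- Only the functions active at `x` in the dependence enter the circuit, and this set serves all
  -- directions at once.
  let S : Finset (Fin (r + 2)) := Finset.univ.filter (ActiveAt (fun i => g (u i)) a x)
  have hS : ∀ i, i ∈ S ↔ ActiveAt (fun i => g (u i)) a x i := fun i => by simp [S]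
  refine ⟨S.image u, fun l hl => ?_, ?_, fun ζ => ?_⟩
  · obtain ⟨i, -, rfl⟩ := Finset.mem_image.1 hl
    exact hT' (e i).2
  · obtain ⟨i, hi⟩ := exists_activeAt (fun i => g (u i)) a x
    exact ⟨u i, Finset.mem_image_of_mem u ((hS i).2 hi)⟩
  · obtain ⟨i, j, hi, hj, hij, he, hm⟩ :=
      exists_ne_slope_eq (g := fun i => g (u i)) (c := a) (fun i => hg _) ha ζ
    refine ⟨u i, Finset.mem_image_of_mem u ((hS i).2 hi), u j,
      Finset.mem_image_of_mem u ((hS j).2 hj), hu.ne hij, he, fun k hk => ?_⟩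
    obtain ⟨m, hm', rfl⟩ := Finset.mem_image.1 hk
    exact hm m ((hS m).1 hm')

/-- Along the segment of length `ε` in direction `η` the functions `g l` are affine, the interior
points have two tangent vectors, and the divisor `D` vanishes there. -/
structure IsChart (g : L → Γ.Point → ℝ) (D : Γ.Divisor) {x : Γ.Point} (η : Γ.Tangent x)
    (ε : ℝ) : Prop where
  pos : 0 < ε
  affine : ∀ l, ∀ h ∈ Set.Icc 0 ε, g l (η.step h) = g l x + slope (g l) η * h
  divisor : ∀ h ∈ Set.Ioo 0 ε, D (η.step h) = 0
  neighbors : ∀ h ∈ Set.Ioo 0 ε, ∃ ζ ζ' : Γ.Tangent (η.step h), ζ ≠ ζ' ∧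
    (∀ ξ, ξ = ζ ∨ ξ = ζ') ∧ (∀ k, ζ.step k = η.step (h + k)) ∧ ∀ k, ζ'.step k = η.step (h - k)

theorem exists_isChart [Finite L] (hg : ∀ l, g l ∈ Γ.PL) (D : Γ.Divisor) {x : Γ.Point}
    (η : Γ.Tangent x) : ∃ ε, IsChart g D η ε := by
  obtain ⟨ε₁, hε₁, h₁⟩ := exists_pos_forall_of_forall_exists_pos fun l => hasSlope_slope (hg l) η
  obtain ⟨ε₂, hε₂, hinj, h₂⟩ := η.exists_neighbors
  have hfin : (Set.Ioo 0 ε₂ ∩ η.step ⁻¹' (D.support : Set Γ.Point)).Finite :=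
    Set.Finite.of_finite_image (D.support.finite_toSet.subset fun _ ⟨_, h, he⟩ => he ▸ h.2)
      (hinj.mono Set.inter_subset_left)
  have : ∃ ε₃ > 0, ∀ h ∈ Set.Ioo 0 ε₃, h ∈ Set.Ioo 0 ε₂ → D (η.step h) = 0 := by
    have hn : (Set.Ioo 0 ε₂ ∩ η.step ⁻¹' (D.support : Set Γ.Point))ᶜ ∈ nhds (0 : ℝ) :=
      hfin.isClosed.isOpen_compl.mem_nhds fun h => lt_irrefl _ h.1.1
    obtain ⟨u, hu, hs⟩ := exists_Ico_subset_of_mem_nhds hn ⟨1, one_pos⟩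
    refine ⟨u, hu, fun h hh hh' => ?_⟩
    by_contra hD
    exact hs ⟨hh.1.le, hh.2⟩ ⟨hh', Finsupp.mem_support_iff.2 hD⟩
  obtain ⟨ε₃, hε₃, h₃⟩ := this
  refine ⟨min ε₁ (min ε₂ ε₃), lt_min hε₁ (lt_min hε₂ hε₃), fun l h hh => ?_, fun h hh => ?_,
    fun h hh => ?_⟩
  · exact h₁ l h ⟨hh.1, hh.2.trans (min_le_left _ _)⟩
  · have := hh.2.trans_le (min_le_right _ _)
    exact h₃ h ⟨hh.1, this.trans_le (min_le_right _ _)⟩ ⟨hh.1, this.trans_le (min_le_left _ _)⟩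
  · exact h₂ h ⟨hh.1, hh.2.trans_le ((min_le_right _ _).trans (min_le_left _ _))⟩

namespace IsChart

variable {D : Γ.Divisor} {x : Γ.Point} {η : Γ.Tangent x} {ε : ℝ}

/-- Concavity: a minimum of affine functions has decreasing slopes, whichever active functions are
compared at the two points. -/
theorem slope_le_of_lt (hc : IsChart g D η ε) {h k : ℝ} (h0 : 0 ≤ h) (hk : k ≤ ε) (hhk : h < k)
    {l m : L} (hl : ActiveAt g c (η.step h) l) (hm : ActiveAt g c (η.step k) m) :
    slope (g m) η ≤ slope (g l) η := by
  have e1 := hl m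
  have e2 := hm l
  rw [hc.affine l h ⟨h0, hhk.le.trans hk⟩, hc.affine m h ⟨h0, hhk.le.trans hk⟩] at e1
  rw [hc.affine l k ⟨h0.trans hhk.le, hk⟩, hc.affine m k ⟨h0.trans hhk.le, hk⟩] at e2
  have : ((slope (g m) η : ℝ) - slope (g l) η) * (k - h) ≤ 0 := by linarith
  have := nonpos_of_mul_nonpos_left this (sub_pos.2 hhk)
  have : (slope (g m) η : ℝ) ≤ slope (g l) η := by linarith
  exact_mod_cast this

/-- A zero of `D + div (minComb g c)` inside the chart is a point where functions of different
slopes are active. -/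
theorem exists_slope_lt [Fintype E] [Fintype L] [Nonempty L] (hg : ∀ l, g l ∈ Γ.PL)
    (hc : IsChart g D η ε) {h : ℝ} (hh : h ∈ Set.Ioo 0 ε)
    (hbend : 1 ≤ ord (minComb g c) (η.step h) + D (η.step h)) :
    ∃ l m, ActiveAt g c (η.step h) l ∧ ActiveAt g c (η.step h) m ∧
      slope (g l) η < slope (g m) η := by
  obtain ⟨ζ, ζ', hne, hall, hs, hs'⟩ := hc.neighbors h hh
  have hsl : ∀ l, slope (g l) ζ = slope (g l) η := fun l => by
    refine HasSlope.slope_eq ⟨ε - h, sub_pos.2 hh.2, fun k hk => ?_⟩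
    rw [hs, hc.affine l _ ⟨by linarith [hh.1, hk.1], by linarith [hk.2]⟩,
      hc.affine l _ ⟨hh.1.le, hh.2.le⟩]
    ring
  have hsl' : ∀ l, slope (g l) ζ' = -slope (g l) η := fun l => by
    refine HasSlope.slope_eq ⟨h, hh.1, fun k hk => ?_⟩
    rw [hs', hc.affine l _ ⟨by linarith [hk.2], by linarith [hh.2, hk.1]⟩,
      hc.affine l _ ⟨hh.1.le, hh.2.le⟩]
    push_cast; ring
  obtain ⟨l, hl, hle, -⟩ := exists_slope_minComb_eq hg c ζ
  obtain ⟨m, hm, hme, -⟩ := exists_slope_minComb_eq hg c ζ'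
  refine ⟨l, m, hl, hm, ?_⟩
  classical
  have huniv : (Finset.univ : Finset (Γ.Tangent (η.step h))) = {ζ, ζ'} := by
    ext ξ; simpa using hall ξ
  rw [ord, huniv, Finset.sum_pair hne, hle, hme, hsl, hsl', hc.divisor h hh] at hbend
  linarith

/-- A function with `m` bends inside the chart has `m + 1` different slopes there. -/
theorem exists_chain [Fintype E] [Fintype L] [Nonempty L] (hg : ∀ l, g l ∈ Γ.PL)
    (hc : IsChart g D η ε) {δ : ℝ} (hδ : 0 < δ) (hδε : δ ≤ ε) (H : Finset ℝ)
    (hH : ∀ h ∈ H, h ∈ Set.Ioo 0 δ ∧ 1 ≤ ord (minComb g c) (η.step h) + D (η.step h)) :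
    ∃ Λ : Finset L, Λ.card = H.card + 1 ∧ Set.InjOn (fun l => slope (g l) η) Λ ∧
      ∀ l ∈ Λ, (∃ h ∈ Set.Ico 0 δ, ActiveAt g c (η.step h) l) ∧
        slope (g l) η ≤ slope (minComb g c) η := by
  classical
  have hex : ∀ h : ℝ, ∃ l, ActiveAt g c (η.step h) l ∧
      ∀ k, ActiveAt g c (η.step h) k → slope (g l) η ≤ slope (g k) η := fun h => by
    have : Nonempty {l // ActiveAt g c (η.step h) l} :=
      (exists_activeAt g c (η.step h)).elim fun l hl => ⟨⟨l, hl⟩⟩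
    obtain ⟨l, hl⟩ := Finite.exists_min fun l : {l // ActiveAt g c (η.step h) l} => slope (g l) η
    exact ⟨l, l.2, fun k hk => hl ⟨k, hk⟩⟩
  -- `p h` is the branch leaving `h` outwards. Its slope drops strictly at each bend, and the base
  -- point 0, which is no bend, contributes the extra slope.
  choose p hp hmin using hex
  have h0 : 0 ∉ H := fun h => lt_irrefl _ (hH 0 h).1.1
  have hI : ∀ h ∈ insert 0 H, h ∈ Set.Ico 0 δ := fun h hh => by
    rcases Finset.mem_insert.1 hh with rfl | hh
    · exact ⟨le_rfl, hδ⟩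
    · exact ⟨(hH h hh).1.1.le, (hH h hh).1.2⟩
  have hanti : ∀ h ∈ insert 0 H, ∀ k ∈ insert 0 H, h < k →
      slope (g (p k)) η < slope (g (p h)) η := fun h hh k hk hhk => by
    have hk' : k ∈ H := (Finset.mem_insert.1 hk).resolve_left ((hI h hh).1.trans_lt hhk).ne'
    obtain ⟨l, m, hl, hm, hlm⟩ := hc.exists_slope_lt hg
      ⟨(hH k hk').1.1, (hH k hk').1.2.trans_le hδε⟩ (hH k hk').2
    exact (hmin k l hl).trans_lt (hlm.trans_le
      (hc.slope_le_of_lt (hI h hh).1 ((hI k hk).2.le.trans hδε) hhk (hp h) hm))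
  have hinj : Set.InjOn (fun h => slope (g (p h)) η) (insert 0 H : Finset ℝ) := by
    intro h hh k hk hhk
    rcases lt_trichotomy h k with hlt | heq | hlt
    · exact absurd hhk (hanti h hh k hk hlt).ne'
    · exact heq
    · exact absurd hhk (hanti k hk h hh hlt).ne
  have hpinj : Set.InjOn p (insert 0 H : Finset ℝ) := fun h hh k hk hhk =>
    hinj hh hk (congrArg (fun l => slope (g l) η) hhk)
  obtain ⟨l₀, hl₀, he₀, -⟩ := exists_slope_minComb_eq hg c η
  have hp0 : slope (g (p 0)) η ≤ slope (minComb g c) η := by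
    rw [he₀]; exact hmin 0 l₀ (by rwa [η.step_zero])
  refine ⟨(insert 0 H).image p, ?_, ?_, fun l hl => ?_⟩
  · rw [Finset.card_image_of_injOn hpinj, Finset.card_insert_of_notMem h0]
  · intro l hl m hm hlm
    obtain ⟨h, hh, rfl⟩ := Finset.mem_image.1 hl
    obtain ⟨k, hk, rfl⟩ := Finset.mem_image.1 hm
    rw [hinj hh hk hlm]
  · obtain ⟨h, hh, rfl⟩ := Finset.mem_image.1 hl
    refine ⟨⟨h, hI h hh, hp h⟩, le_trans ?_ hp0⟩
    rcases (hI h hh).1.eq_or_lt with h' | h'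
    · rw [← h']
    · exact (hanti 0 (Finset.mem_insert_self _ _) h hh h').le

end IsChart

end MinComb

end MetricGraph

/-! ### Circuits and lattice paths of slopes -/

namespace MetricGraph

section Circuits

variable {L T : Type*} {σ : T → L → ℤ} {n : ℕ}

theorem not_isCircuit_of_lt {A : Finset L} {l : L} {t : T} (hl : l ∈ A)
    (h : ∀ k ∈ A, k ≠ l → σ t l < σ t k) : ¬ IsCircuit σ A := fun ⟨_, hA⟩ => by
  obtain ⟨i, hi, j, hj, hij, he, hm⟩ := hA t
  have h1 : i = l := by
    by_contra hil
    exact (h i hi hil).not_ge (hm l hl)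
  have h2 : j = l := by
    by_contra hjl
    exact (h j hj hjl).not_ge (he ▸ hm l hl)
  exact hij (h1.trans h2.symm)

theorem not_isCircuit_of_injOn {A : Finset L} {t : T} (h : Set.InjOn (σ t) A) :
    ¬ IsCircuit σ A := fun ⟨_, hA⟩ => by
  obtain ⟨i, hi, j, hj, hij, he, -⟩ := hA t
  exact hij (h hi hj he)

variable (σ) in
/-- `c` is the number of counted steps of a monotone lattice path from `(a₀, b₀)` to `(a, b)`.  A
step to the right from `(a, b)` is counted if some `l` has `σ η l = a` and `b ≤ σ ξ l`, and a step
upwards is counted if some `l` has `σ ξ l = b` and `a ≤ σ η l`. -/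
inductive LatticePath (η ξ : T) (a₀ b₀ : ℤ) : ℤ → ℤ → ℕ → Prop
  | start : LatticePath η ξ a₀ b₀ a₀ b₀ 0
  | right {a b : ℤ} {c : ℕ} (h : LatticePath η ξ a₀ b₀ a b c) {l : L} (ha : σ η l = a)
      (hb : b ≤ σ ξ l) : LatticePath η ξ a₀ b₀ (a + 1) b (c + 1)
  | right_skip {a b : ℤ} {c : ℕ} (h : LatticePath η ξ a₀ b₀ a b c)
      (hs : ∀ l, σ η l = a → σ ξ l < b) : LatticePath η ξ a₀ b₀ (a + 1) b c
  | up {a b : ℤ} {c : ℕ} (h : LatticePath η ξ a₀ b₀ a b c) {l : L} (hb : σ ξ l = b)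
      (ha : a ≤ σ η l) : LatticePath η ξ a₀ b₀ a (b + 1) (c + 1)
  | up_skip {a b : ℤ} {c : ℕ} (h : LatticePath η ξ a₀ b₀ a b c)
      (hs : ∀ l, σ ξ l = b → σ η l < a) : LatticePath η ξ a₀ b₀ a (b + 1) c

namespace LatticePath

variable {η ξ : T} {a₀ b₀ a b : ℤ} {c : ℕ}

/-- The counted steps of a path give an independent set, which stays independent together with
functions of slopes at least `(a, b)`. -/
theorem exists_independent (h : LatticePath σ η ξ a₀ b₀ a b c) :
    ∃ R : Finset L, R.card = c ∧ (∀ l ∈ R, ¬ (a ≤ σ η l ∧ b ≤ σ ξ l)) ∧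
      ∀ A : Finset L, (∀ l ∈ A, l ∈ R ∨ (a ≤ σ η l ∧ b ≤ σ ξ l)) → (∃ l ∈ A, l ∈ R) →
        ¬ IsCircuit σ A := by
  classical
  induction h with
  | start => exact ⟨∅, rfl, by simp, by simp⟩
  | @right a b c _ l ha hb ih =>
    obtain ⟨R, hc, hR, hA⟩ := ih
    have hlR : l ∉ R := fun h => hR l h ⟨ha.ge, hb⟩
    refine ⟨insert l R, by rw [Finset.card_insert_of_notMem hlR, hc], fun k hk => ?_,
      fun A hAR hex => ?_⟩
    · rcases Finset.mem_insert.1 hk with rfl | hk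
      · exact fun h => by omega
      · exact fun h => hR k hk ⟨by omega, h.2⟩
    · by_cases hex' : ∃ k ∈ A, k ∈ R
      · refine hA A (fun k hk => ?_) hex'
        rcases hAR k hk with h | h
        · rcases Finset.mem_insert.1 h with rfl | h
          · exact Or.inr ⟨ha.ge, hb⟩
          · exact Or.inl h
        · exact Or.inr ⟨by omega, h.2⟩
      · obtain ⟨k, hkA, hk⟩ := hex
        have hkl : k = l := (Finset.mem_insert.1 hk).resolve_right fun h => hex' ⟨k, hkA, h⟩
        subst hkl
        -- All other members of `A` have slope at least `a + 1` along `η`, so the new element is the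
        -- only one of least slope.
        refine not_isCircuit_of_lt (t := η) hkA fun m hm hmk => ?_
        rcases hAR m hm with h | h
        · exact absurd ((Finset.mem_insert.1 h).resolve_left hmk) fun h => hex' ⟨m, hm, h⟩
        · omega
  | right_skip _ hs ih =>
    obtain ⟨R, hc, hR, hA⟩ := ih
    refine ⟨R, hc, fun k hk h => hR k hk ⟨by omega, h.2⟩, fun A hAR => hA A fun k hk => ?_⟩
    exact (hAR k hk).imp id fun h => ⟨by omega, h.2⟩
  | @up a b c _ l hb ha ih =>
    obtain ⟨R, hc, hR, hA⟩ := ih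
    have hlR : l ∉ R := fun h => hR l h ⟨ha, hb.ge⟩
    refine ⟨insert l R, by rw [Finset.card_insert_of_notMem hlR, hc], fun k hk => ?_,
      fun A hAR hex => ?_⟩
    · rcases Finset.mem_insert.1 hk with rfl | hk
      · exact fun h => by omega
      · exact fun h => hR k hk ⟨h.1, by omega⟩
    · by_cases hex' : ∃ k ∈ A, k ∈ R
      · refine hA A (fun k hk => ?_) hex'
        rcases hAR k hk with h | h
        · rcases Finset.mem_insert.1 h with rfl | h
          · exact Or.inr ⟨ha, hb.ge⟩
          · exact Or.inl h
        · exact Or.inr ⟨h.1, by omega⟩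
      · obtain ⟨k, hkA, hk⟩ := hex
        have hkl : k = l := (Finset.mem_insert.1 hk).resolve_right fun h => hex' ⟨k, hkA, h⟩
        subst hkl
        refine not_isCircuit_of_lt (t := ξ) hkA fun m hm hmk => ?_
        rcases hAR m hm with h | h
        · exact absurd ((Finset.mem_insert.1 h).resolve_left hmk) fun h => hex' ⟨m, hm, h⟩
        · omega
  | up_skip _ hs ih =>
    obtain ⟨R, hc, hR, hA⟩ := ih
    refine ⟨R, hc, fun k hk h => hR k hk ⟨h.1, by omega⟩, fun A hAR => hA A fun k hk => ?_⟩
    exact (hAR k hk).imp id fun h => ⟨h.1, by omega⟩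

/-- A circuit in the union of the independent set of the path with `Λ` cannot meet the former, and
inside `Λ` distinct slopes along `η` exclude it. -/
theorem add_card_le (h : LatticePath σ η ξ a₀ b₀ a b c)
    (hcirc : ∀ R : Finset L, n + 1 ≤ R.card → ∃ A ⊆ R, IsCircuit σ A) (Λ : Finset L)
    (hΛ : ∀ l ∈ Λ, a ≤ σ η l ∧ b ≤ σ ξ l) (hinj : Set.InjOn (σ η) Λ) : c + Λ.card ≤ n := by
  classical
  obtain ⟨R, hc, hR, hA⟩ := h.exists_independent
  by_contra hlt
  have hd : Disjoint R Λ := Finset.disjoint_left.2 fun l hl hl' => hR l hl (hΛ l hl')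
  obtain ⟨A, hAR, hAc⟩ := hcirc (R ∪ Λ) (by rw [Finset.card_union_of_disjoint hd]; omega)
  by_cases hex : ∃ l ∈ A, l ∈ R
  · exact hA A (fun l hl => (Finset.mem_union.1 (hAR hl)).imp id (hΛ l)) hex hAc
  · refine not_isCircuit_of_injOn (t := η) (hinj.mono fun l hl => ?_) hAc
    exact (Finset.mem_union.1 (hAR hl)).resolve_left fun h => hex ⟨l, hl, h⟩

theorem exists_right (h : LatticePath σ η ξ a₀ b₀ a b c) :
    ((∃ l, σ η l = a ∧ b ≤ σ ξ l) ∧ LatticePath σ η ξ a₀ b₀ (a + 1) b (c + 1)) ∨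
      ((∀ l, σ η l = a → σ ξ l < b) ∧ LatticePath σ η ξ a₀ b₀ (a + 1) b c) := by
  by_cases hl : ∃ l, σ η l = a ∧ b ≤ σ ξ l
  · obtain ⟨l, h1, h2⟩ := hl
    exact Or.inl ⟨⟨l, h1, h2⟩, h.right h1 h2⟩
  · push Not at hl
    exact Or.inr ⟨hl, h.right_skip hl⟩

theorem exists_up (h : LatticePath σ η ξ a₀ b₀ a b c) :
    ((∃ l, σ ξ l = b ∧ a ≤ σ η l) ∧ LatticePath σ η ξ a₀ b₀ a (b + 1) (c + 1)) ∨
      ((∀ l, σ ξ l = b → σ η l < a) ∧ LatticePath σ η ξ a₀ b₀ a (b + 1) c) := by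
  by_cases hl : ∃ l, σ ξ l = b ∧ a ≤ σ η l
  · obtain ⟨l, h1, h2⟩ := hl
    exact Or.inl ⟨⟨l, h1, h2⟩, h.up h1 h2⟩
  · push Not at hl
    exact Or.inr ⟨hl, h.up_skip hl⟩

theorem exists_of_le (ha : a₀ ≤ a) (hb : b₀ ≤ b) : ∃ c, LatticePath σ η ξ a₀ b₀ a b c := by
  induction a, ha using Int.leInduction with
  | base =>
    induction b, hb using Int.leInduction with
    | base => exact ⟨0, start⟩
    | succ b _ ih =>
      obtain ⟨c, hc⟩ := ih
      rcases hc.exists_up with h | h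
      · exact ⟨_, h.2⟩
      · exact ⟨_, h.2⟩
  | succ a _ ih =>
    obtain ⟨c, hc⟩ := ih
    rcases hc.exists_right with h | h
    · exact ⟨_, h.2⟩
    · exact ⟨_, h.2⟩

/-- If the number of counted steps depends on the end point only, an element which is the last one
of its column `σ η = a` is the last one of its row. -/
theorem le_of_isMax (huniq : ∀ a b c c', LatticePath σ η ξ a₀ b₀ a b c →
      LatticePath σ η ξ a₀ b₀ a b c' → c = c') {l : L} (ha : a₀ ≤ σ η l) (hb : b₀ ≤ σ ξ l)
    (hmax : ∀ k, σ η k = σ η l → σ ξ k ≤ σ ξ l) {k : L} (hk : σ ξ k = σ ξ l) :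
    σ η k ≤ σ η l := by
  obtain ⟨c, hc⟩ := exists_of_le (σ := σ) (η := η) (ξ := ξ) ha hb
  by_contra hlt
  -- The two ways round a unit square: right then up counts two steps, through `l` and `k`. Up then
  -- right counts only one, as nothing in the column of `l` lies above `l`.
  have p1 := (hc.right (l := l) rfl le_rfl).up (l := k) hk (by omega)
  have p2 := (hc.up (l := l) rfl le_rfl).right_skip fun m hm => by
    have := hmax m hm
    omega
  have := huniq _ _ _ _ p1 p2
  omega

end LatticePath

end Circuits

end MetricGraph

/-! ### Divisors, and rank under lower bounds on two slopes -/

namespace MetricGraph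

variable {V E : Type*} {Γ : MetricGraph V E}

namespace Divisor

theorem degree_add (F F' : Γ.Divisor) : degree (F + F') = degree F + degree F' :=
  Finsupp.sum_add_index' (fun _ => rfl) fun _ _ _ => rfl

theorem degree_single (x : Γ.Point) (n : ℤ) : degree (Finsupp.single x n) = n :=
  Finsupp.sum_single_index rfl

theorem degree_sum {ι : Type*} (s : Finset ι) (F : ι → Γ.Divisor) :
    degree (∑ i ∈ s, F i) = ∑ i ∈ s, degree (F i) := by
  classical
  induction s using Finset.induction_on with
  | empty => rfl
  | insert i s hi ih => rw [Finset.sum_insert hi, Finset.sum_insert hi, degree_add, ih]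

/-- The sum of the points `p i`. -/
noncomputable def ofPoints {ι : Type*} (s : Finset ι) (p : ι → Γ.Point) : Γ.Divisor :=
  ∑ i ∈ s, Finsupp.single (p i) 1

theorem degree_ofPoints {ι : Type*} (s : Finset ι) (p : ι → Γ.Point) :
    degree (ofPoints s p) = s.card := by
  simp [ofPoints, degree_sum, degree_single]

theorem ofPoints_nonneg {ι : Type*} (s : Finset ι) (p : ι → Γ.Point) : 0 ≤ ofPoints s p :=
  Finset.sum_nonneg fun _ _ => Finsupp.single_nonneg.2 zero_le_one

theorem one_le_ofPoints {ι : Type*} {s : Finset ι} (p : ι → Γ.Point) {i : ι} (hi : i ∈ s) :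
    1 ≤ ofPoints s p (p i) := by
  have h : Finsupp.single (p i) (1 : ℤ) ≤ ofPoints s p :=
    Finset.single_le_sum (f := fun i => (Finsupp.single (p i) (1 : ℤ) : Γ.Divisor))
      (fun _ _ => Finsupp.single_nonneg.2 zero_le_one) hi
  simpa using h (p i)

end Divisor

theorem exists_finset_Ioo {δ : ℝ} (hδ : 0 < δ) (m : ℕ) :
    ∃ H : Finset ℝ, H.card = m ∧ ∀ h ∈ H, h ∈ Set.Ioo 0 δ := by
  obtain ⟨H, hH, hc⟩ := (Set.Ioo_infinite hδ).exists_subset_card_eq m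
  exact ⟨H, hc, fun h hh => hH hh⟩

section Flags

variable {L : Type*} [Fintype L] [Nonempty L] {g : L → Γ.Point → ℝ} {D : Γ.Divisor}
  {x : Γ.Point} {η ξ : Γ.Tangent x} {ε ε' : ℝ} {r : ℕ}

/-- Every slope of a function along `η`, much closer to `x` than `h'`, belongs to a function whose
slope along `ξ` is at least that of the functions active at distance `h'`. -/
theorem exists_scale (hc : IsChart g D η ε) (hc' : IsChart g D ξ ε') :
    ∃ C ≥ 0, ∀ (c : L → ℝ) (h h' : ℝ) (b : ℤ) (l : L), h ∈ Set.Icc 0 ε → h' ∈ Set.Icc 0 ε' →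
      C * h < h' → ActiveAt g c (η.step h) l →
      (∀ m, ActiveAt g c (ξ.step h') m → b ≤ slope (g m) ξ) → b ≤ slope (g l) ξ := by
  -- If `l` is active at distance `h`, its excess over the minimum at `x` is at most `C * h`. A
  -- slope along `ξ` below that of a function active at `h'` would make this excess at least `h'`.
  refine ⟨2 * ∑ l, |(slope (g l) η : ℝ)|, by positivity, fun c h h' b l hh hh' hlt hl hm => ?_⟩
  by_contra hb
  obtain ⟨m, hma⟩ := exists_activeAt g c (ξ.step h')
  obtain ⟨k, hk⟩ := exists_activeAt g c x
  have e1 := hl k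
  have e2 := hma l
  have e3 := hk m
  rw [hc.affine l h hh, hc.affine k h hh] at e1
  rw [hc'.affine l h' hh', hc'.affine m h' hh'] at e2
  have e4 : (slope (g l) ξ : ℝ) + 1 ≤ slope (g m) ξ := by
    have := hm m hma
    exact_mod_cast (by omega : slope (g l) ξ + 1 ≤ slope (g m) ξ)
  have e5 := mul_le_mul_of_nonneg_right e4 hh'.1
  have a1 := Finset.single_le_sum (f := fun l => |(slope (g l) η : ℝ)|)
    (fun _ _ => abs_nonneg _) (Finset.mem_univ l)
  have a2 := Finset.single_le_sum (f := fun l => |(slope (g l) η : ℝ)|)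
    (fun _ _ => abs_nonneg _) (Finset.mem_univ k)
  have e6 : (slope (g k) η : ℝ) - slope (g l) η ≤ 2 * ∑ l, |(slope (g l) η : ℝ)| := by
    linarith [neg_abs_le (slope (g l) η : ℝ), le_abs_self (slope (g k) η : ℝ)]
  have e7 := mul_le_mul_of_nonneg_right e6 hh.1
  linarith

theorem exists_forall_le_slope (g : L → Γ.Point → ℝ) (η : Γ.Tangent x) :
    ∃ a, ∀ l, a ≤ slope (g l) η := by
  obtain ⟨l, hl⟩ := Finite.exists_min fun l => slope (g l) η
  exact ⟨_, hl⟩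

variable [Fintype E]

/-- The functions with slopes at least `a` along `η` and at least `b` along `ξ`, on segments of
fixed positive lengths, have Baker-Norine rank at least `k`. -/
def FlagRank (g : L → Γ.Point → ℝ) (D : Γ.Divisor) (η ξ : Γ.Tangent x) (ε ε' : ℝ) (a b : ℤ)
    (k : ℕ) : Prop :=
  ∃ δ ∈ Set.Ioc 0 ε, ∃ δ' ∈ Set.Ioc 0 ε', ∀ F : Γ.Divisor, 0 ≤ F → Divisor.degree F = k →
    ∃ c, BakerNorineRank D F (minComb g c) ∧
      (∀ h ∈ Set.Ico 0 δ, ∀ l, ActiveAt g c (η.step h) l → a ≤ slope (g l) η) ∧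
      ∀ h ∈ Set.Ico 0 δ', ∀ l, ActiveAt g c (ξ.step h) l → b ≤ slope (g l) ξ

namespace FlagRank

variable {a b : ℤ} {k : ℕ}

theorem symm (h : FlagRank g D η ξ ε ε' a b k) : FlagRank g D ξ η ε' ε b a k := by
  obtain ⟨δ, hδ, δ', hδ', h⟩ := h
  refine ⟨δ', hδ', δ, hδ, fun F hF hd => ?_⟩
  obtain ⟨c, h1, h2, h3⟩ := h F hF hd
  exact ⟨c, h1, h3, h2⟩

/-- One point of the divisor is spent at the middle of the segment. The bend there involves a slope
larger than `a`, and by concavity all slopes before it exceed `a`. -/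
theorem succ_left (hg : ∀ l, g l ∈ Γ.PL) (hc : IsChart g D η ε)
    (h : FlagRank g D η ξ ε ε' a b (k + 1)) : FlagRank g D η ξ ε ε' (a + 1) b k := by
  obtain ⟨δ, hδ, δ', hδ', h⟩ := h
  have hδ2 : δ / 2 ∈ Set.Ioo 0 δ := ⟨half_pos hδ.1, half_lt_self hδ.1⟩
  refine ⟨δ / 2, ⟨hδ2.1, hδ2.2.le.trans hδ.2⟩, δ', hδ', fun F hF hd => ?_⟩
  have hs : (0 : Γ.Divisor) ≤ Finsupp.single (η.step (δ / 2)) 1 :=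
    Finsupp.single_nonneg.2 zero_le_one
  obtain ⟨c, h1, h2, h3⟩ := h (F + Finsupp.single (η.step (δ / 2)) 1) (add_nonneg hF hs) (by
    rw [Divisor.degree_add, Divisor.degree_single, hd]; push_cast; rfl)
  refine ⟨c, fun y => le_trans ?_ (h1 y), fun t ht l hl => ?_, h3⟩
  · simpa using hs y
  · have hb : 1 ≤ ord (minComb g c) (η.step (δ / 2)) + D (η.step (δ / 2)) := by
      refine le_trans ?_ (h1 _)
      simpa using hF (η.step (δ / 2))
    obtain ⟨m, m', hm, hm', hlt⟩ := hc.exists_slope_lt hg ⟨hδ2.1, hδ2.2.trans_le hδ.2⟩ hb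
    have e1 := h2 _ ⟨hδ2.1.le, hδ2.2⟩ m hm
    have e2 := hc.slope_le_of_lt ht.1 (hδ2.2.le.trans hδ.2) ht.2 hl hm'
    omega

/-- On a short segment along `η` all active functions have slope at least `b` along `ξ`. -/
theorem exists_shrink (hc : IsChart g D η ε) (hc' : IsChart g D ξ ε')
    (h : FlagRank g D η ξ ε ε' a b k) :
    ∃ δ ∈ Set.Ioc 0 ε, ∃ δ' ∈ Set.Ioc 0 ε', ∀ F : Γ.Divisor, 0 ≤ F → Divisor.degree F = k →
      ∃ c, BakerNorineRank D F (minComb g c) ∧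
        (∀ h ∈ Set.Ico 0 δ, ∀ l, ActiveAt g c (η.step h) l →
          a ≤ slope (g l) η ∧ b ≤ slope (g l) ξ) ∧
        ∀ h ∈ Set.Ico 0 δ', ∀ l, ActiveAt g c (ξ.step h) l → b ≤ slope (g l) ξ := by
  obtain ⟨δ, hδ, δ', hδ', h⟩ := h
  obtain ⟨C, hC, hsc⟩ := exists_scale hc hc'
  have hC1 : 0 < C + 1 := by linarith
  -- Below this distance `t` one has `C * t < δ' / 2`, as needed to compare with the point at
  -- distance `δ' / 2` along `ξ`; `C + 1` avoids division by zero.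
  have hd : 0 < δ' / 2 / (C + 1) := div_pos (half_pos hδ'.1) hC1
  refine ⟨min δ (δ' / 2 / (C + 1)), ⟨lt_min hδ.1 hd, (min_le_left _ _).trans hδ.2⟩, δ', hδ',
    fun F hF hdeg => ?_⟩
  obtain ⟨c, h1, h2, h3⟩ := h F hF hdeg
  refine ⟨c, h1, fun t ht l hl => ?_, h3⟩
  have ht1 : t < δ := ht.2.trans_le (min_le_left _ _)
  have ht2 := (lt_div_iff₀ hC1).1 (ht.2.trans_le (min_le_right _ _))
  refine ⟨h2 t ⟨ht.1, ht1⟩ l hl, hsc c t (δ' / 2) b l ⟨ht.1, ht1.le.trans hδ.2⟩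
    ⟨(half_pos hδ'.1).le, (half_lt_self hδ'.1).le.trans hδ'.2⟩ (by linarith [ht.1]) hl ?_⟩
  exact h3 _ ⟨(half_pos hδ'.1).le, half_lt_self hδ'.1⟩

/-- Close enough to `x` both bounds hold for every function active along `η`, so slope `a` cannot
occur and the bound rises at no cost. -/
theorem skip_left (hc : IsChart g D η ε) (hc' : IsChart g D ξ ε')
    (h : FlagRank g D η ξ ε ε' a b k) (hs : ∀ l, slope (g l) η = a → slope (g l) ξ < b) :
    FlagRank g D η ξ ε ε' (a + 1) b k := by
  obtain ⟨δ, hδ, δ', hδ', h⟩ := h.exists_shrink hc hc'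
  refine ⟨δ, hδ, δ', hδ', fun F hF hd => ?_⟩
  obtain ⟨c, h1, h2, h3⟩ := h F hF hd
  refine ⟨c, h1, fun t ht l hl => ?_, h3⟩
  have := h2 t ht l hl
  have := hs l
  omega

/-- Place `k` points on the shrunken segment along `η`: the `k` bends display `k + 1` slopes, all on
functions satisfying both bounds. -/
theorem exists_card_eq (hg : ∀ l, g l ∈ Γ.PL) (hc : IsChart g D η ε) (hc' : IsChart g D ξ ε')
    (h : FlagRank g D η ξ ε ε' a b k) : ∃ Λ : Finset L, Λ.card = k + 1 ∧
      Set.InjOn (fun l => slope (g l) η) Λ ∧ ∀ l ∈ Λ, a ≤ slope (g l) η ∧ b ≤ slope (g l) ξ := by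
  obtain ⟨δ, hδ, δ', hδ', h⟩ := h.exists_shrink hc hc'
  obtain ⟨H, hcard, hH⟩ := exists_finset_Ioo hδ.1 k
  obtain ⟨c, h1, h2, -⟩ := h (Divisor.ofPoints H η.step) (Divisor.ofPoints_nonneg _ _)
    (by rw [Divisor.degree_ofPoints, hcard])
  obtain ⟨Λ, hΛ, hinj, hact⟩ := hc.exists_chain (c := c) hg hδ.1 hδ.2 H fun t ht =>
    ⟨hH t ht, (Divisor.one_le_ofPoints η.step ht).trans (h1 _)⟩
  refine ⟨Λ, hΛ.trans (by rw [hcard]), hinj, fun l hl => ?_⟩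
  obtain ⟨⟨t, ht, hl⟩, -⟩ := hact l hl
  exact h2 t ht l hl

end FlagRank

/-- A counted step costs one point of rank and an uncounted one costs nothing; steps upwards follow
from steps to the right by symmetry. -/
theorem flagRank_of_latticePath (hg : ∀ l, g l ∈ Γ.PL) (hc : IsChart g D η ε)
    (hc' : IsChart g D ξ ε') {a₀ b₀ : ℤ} (h₀ : FlagRank g D η ξ ε ε' a₀ b₀ r) {a b : ℤ} {c : ℕ}
    (h : LatticePath (fun (ζ : Γ.Tangent x) l => slope (g l) ζ) η ξ a₀ b₀ a b c) :
    ∀ k, c + k = r → FlagRank g D η ξ ε ε' a b k := by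
  induction h with
  | start => intro k hk; rwa [← hk, zero_add] at h₀
  | right _ _ _ ih => intro k hk; exact (ih (k + 1) (by omega)).succ_left hg hc
  | right_skip _ hs ih => intro k hk; exact (ih k hk).skip_left hc hc' hs
  | up _ _ _ ih => intro k hk; exact ((ih (k + 1) (by omega)).symm.succ_left hg hc').symm
  | up_skip _ hs ih => intro k hk; exact ((ih k hk).symm.skip_left hc' hc hs).symm

theorem flagRank_of_le (hc : IsChart g D η ε) (hc' : IsChart g D ξ ε')
    (hrank : ∀ F : Γ.Divisor, 0 ≤ F → Divisor.degree F = r →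
      ∃ c, BakerNorineRank D F (minComb g c)) {a b : ℤ} (ha : ∀ l, a ≤ slope (g l) η)
    (hb : ∀ l, b ≤ slope (g l) ξ) : FlagRank g D η ξ ε ε' a b r :=
  ⟨ε, ⟨hc.pos, le_rfl⟩, ε', ⟨hc'.pos, le_rfl⟩, fun F hF hd =>
    (hrank F hF hd).imp fun _ h => ⟨h, fun _ _ l _ => ha l, fun _ _ l _ => hb l⟩⟩

/-- There are exactly `r + 1` slopes in each direction. -/
theorem card_image_slope (hg : ∀ l, g l ∈ Γ.PL)
    (hrank : ∀ F : Γ.Divisor, 0 ≤ F → Divisor.degree F = r →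
      ∃ c, BakerNorineRank D F (minComb g c))
    (hcirc : ∀ R : Finset L, r + 2 ≤ R.card →
      ∃ A ⊆ R, IsCircuit (fun (ζ : Γ.Tangent x) l => slope (g l) ζ) A) (η : Γ.Tangent x) :
    (Finset.univ.image fun l => slope (g l) η).card = r + 1 := by
  classical
  obtain ⟨ε, hc⟩ := exists_isChart hg D η
  obtain ⟨a, ha⟩ := exists_forall_le_slope g η
  refine le_antisymm ?_ ?_
  · by_contra hlt
    have hex : ∀ s : Finset.univ.image fun l => slope (g l) η, ∃ l, slope (g l) η = s := fun s => by
      obtain ⟨l, -, hl⟩ := Finset.mem_image.1 s.2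
      exact ⟨l, hl⟩
    choose p hp using hex
    have hpinj : Function.Injective p := fun s t hst => Subtype.ext (by rw [← hp s, ← hp t, hst])
    obtain ⟨A, hA, hAc⟩ := hcirc (Finset.univ.image p) (by
      rw [Finset.card_image_of_injective _ hpinj, Finset.card_univ, Fintype.card_coe]
      omega)
    refine not_isCircuit_of_injOn (t := η) (fun l hl m hm hlm => ?_) hAc
    obtain ⟨s, -, rfl⟩ := Finset.mem_image.1 (hA hl)
    obtain ⟨t, -, rfl⟩ := Finset.mem_image.1 (hA hm)
    simp only [hp] at hlm
    rw [Subtype.ext hlm]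
  · obtain ⟨Λ, hΛ, hinj, -⟩ := (flagRank_of_le hc hc hrank ha ha).exists_card_eq hg hc hc
    rw [← hΛ, ← Finset.card_image_of_injOn hinj]
    exact Finset.card_le_card (Finset.image_subset_image (Finset.subset_univ _))

/-- The function `g l` dominates all functions sharing a slope with it. -/
def IsDot (g : L → Γ.Point → ℝ) (x : Γ.Point) (l : L) : Prop :=
  ∀ k, (∃ ζ : Γ.Tangent x, slope (g k) ζ = slope (g l) ζ) →
    ∀ ζ : Γ.Tangent x, slope (g k) ζ ≤ slope (g l) ζ

/-- Rank and dependence make the count of a lattice path depend only on its end. The generator of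
slope `slope (g l) η` with the largest slope along `ξ` is then also the largest in its row. -/
theorem exists_isDot (hg : ∀ l, g l ∈ Γ.PL)
    (hrank : ∀ F : Γ.Divisor, 0 ≤ F → Divisor.degree F = r →
      ∃ c, BakerNorineRank D F (minComb g c))
    (hcirc : ∀ R : Finset L, r + 2 ≤ R.card →
      ∃ A ⊆ R, IsCircuit (fun (ζ : Γ.Tangent x) l => slope (g l) ζ) A) (hx : Γ.ThinAt x)
    (η : Γ.Tangent x) (l : L) : ∃ d, IsDot g x d ∧ slope (g d) η = slope (g l) η := by
  -- At an end point of an interval `ξ = η`, and the argument runs unchanged.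
  obtain ⟨ξ, hξ⟩ : ∃ ξ, ∀ ζ, ζ = η ∨ ζ = ξ := by
    obtain ⟨η₁, η₂, h⟩ := hx
    rcases h η with rfl | rfl
    · exact ⟨η₂, h⟩
    · exact ⟨η₁, fun ζ => (h ζ).symm⟩
  obtain ⟨ε, hc⟩ := exists_isChart hg D η
  obtain ⟨ε', hc'⟩ := exists_isChart hg D ξ
  obtain ⟨a, ha⟩ := exists_forall_le_slope g η
  obtain ⟨b, hb⟩ := exists_forall_le_slope g ξ
  have h₀ := flagRank_of_le hc hc' hrank ha hb
  have huniq : ∀ (a' b' : ℤ) (c : ℕ),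
      LatticePath (fun (ζ : Γ.Tangent x) l => slope (g l) ζ) η ξ a b a' b' c → ∀ c',
      LatticePath (fun (ζ : Γ.Tangent x) l => slope (g l) ζ) η ξ a b a' b' c' → c ≤ c' := by
    intro a' b' c h c' h'
    rcases le_or_gt c' r with hr | hr
    · obtain ⟨Λ, hΛ, hinj, hge⟩ := (flagRank_of_latticePath hg hc hc' h₀ h' (r - c')
        (by omega)).exists_card_eq hg hc hc'
      have := h.add_card_le hcirc Λ hge hinj
      omega
    -- No rank is left here, but any independent set has at most `r + 1 ≤ c'` elements.
    · have := h.add_card_le hcirc ∅ (by simp) (by simp)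
      simp at this
      omega
  have : Nonempty {k // slope (g k) η = slope (g l) η} := ⟨⟨l, rfl⟩⟩
  obtain ⟨⟨d, hd⟩, hmax⟩ :=
    Finite.exists_max fun k : {k // slope (g k) η = slope (g l) η} => slope (g k) ξ
  have hrow : ∀ k, slope (g k) η = slope (g d) η → slope (g k) ξ ≤ slope (g d) ξ :=
    fun k hk => hmax ⟨k, hk.trans hd⟩
  have hcol : ∀ k, slope (g k) ξ = slope (g d) ξ → slope (g k) η ≤ slope (g d) η :=
    fun k hk => LatticePath.le_of_isMax (σ := fun (ζ : Γ.Tangent x) l => slope (g l) ζ)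
      (fun a' b' c c' h h' => le_antisymm (huniq _ _ _ h _ h') (huniq _ _ _ h' _ h))
      (ha d) (hb d) hrow hk
  refine ⟨d, fun k ⟨ζ, hζ⟩ ζ' => ?_, hd⟩
  rcases hξ ζ with rfl | rfl <;> rcases hξ ζ' with rfl | rfl
  · exact hζ.le
  · exact hrow k hζ
  · exact hcol k hζ
  · exact hζ.le

end Flags

end MetricGraph

/-! ### Tropical spans: closedness and normalised coefficients -/

namespace MetricGraph

variable {V E : Type*} {Γ : MetricGraph V E}

section Span

variable {L : Type*} [Fintype L] [Nonempty L] {g : L → Γ.Point → ℝ}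

theorem tropComb_le {n : ℕ} (f : Fin (n + 1) → Γ.Point → ℝ) (a : Fin (n + 1) → ℝ) (x : Γ.Point)
    (i : Fin (n + 1)) : tropComb f a x ≤ f i x + a i :=
  Finset.inf'_le _ (Finset.mem_univ i)

theorem exists_tropComb_eq {n : ℕ} (f : Fin (n + 1) → Γ.Point → ℝ) (a : Fin (n + 1) → ℝ)
    (x : Γ.Point) : ∃ i, tropComb f a x = f i x + a i := by
  obtain ⟨i, -, hi⟩ := Finset.exists_mem_eq_inf' Finset.univ_nonempty fun i => f i x + a i
  exact ⟨i, hi⟩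

theorem minComb_mem_tropSpan (g : L → Γ.Point → ℝ) (c : L → ℝ) :
    minComb g c ∈ tropSpan (Set.range g) := by
  obtain ⟨n, hn⟩ : ∃ n, Fintype.card L = n + 1 :=
    ⟨Fintype.card L - 1, (Nat.succ_pred_eq_of_pos Fintype.card_pos).symm⟩
  let e : Fin (n + 1) ≃ L := (Fintype.equivFinOfCardEq hn).symm
  refine ⟨n, fun i => g (e i), fun i => c (e i), fun i => ⟨_, rfl⟩, funext fun x => ?_⟩
  obtain ⟨l, hl⟩ := exists_activeAt g c x
  obtain ⟨i, hi⟩ := exists_tropComb_eq (fun i => g (e i)) (fun i => c (e i)) x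
  refine le_antisymm (hi ▸ minComb_le x _) ?_
  rw [hl.minComb_eq]
  simpa using tropComb_le (fun i => g (e i)) (fun i => c (e i)) x (e.symm l)

/-- A bounded limit of tropical combinations of finitely many bounded functions is a tropical
combination of them. -/
theorem exists_eq_minComb_of_approx [Nonempty Γ.Point] (hg : ∀ l, ∃ K, ∀ x, |g l x| ≤ K)
    {f : Γ.Point → ℝ} (hf : ∃ K, ∀ x, |f x| ≤ K)
    (happ : ∀ ε > 0, ∃ u ∈ tropSpan (Set.range g), ∀ x, |f x - u x| ≤ ε) :
    ∃ c, f = minComb g c := by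
  have hbdd : ∀ l, BddAbove (Set.range fun x => f x - g l x) := fun l => by
    obtain ⟨K, hK⟩ := hg l
    obtain ⟨K', hK'⟩ := hf
    refine ⟨K' + K, ?_⟩
    rintro _ ⟨x, rfl⟩
    have := abs_le.1 (hK x)
    have := abs_le.1 (hK' x)
    linarith
  -- The least coefficients with `f ≤ g l + c l`. Those of an `ε / 2`-approximation can be smaller
  -- by at most `ε / 2`.
  refine ⟨fun l => ⨆ x, (f x - g l x), funext fun x => le_antisymm ?_ ?_⟩
  · refine Finset.le_inf' _ _ fun l _ => ?_
    have := le_ciSup (hbdd l) x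
    linarith
  · refine le_of_forall_pos_le_add fun ε hε => ?_
    obtain ⟨_, ⟨n, u, a, hu, rfl⟩, h⟩ := happ (ε / 2) (half_pos hε)
    obtain ⟨i, hi⟩ := exists_tropComb_eq u a x
    obtain ⟨l, hl⟩ := hu i
    have h1 : ⨆ y, (f y - g l y) ≤ a i + ε / 2 := ciSup_le fun y => by
      have h2 := tropComb_le u a y i
      have h3 := (abs_le.1 (h y)).2
      rw [← hl] at h2
      linarith
    have h4 := minComb_le (g := g) (c := fun l => ⨆ x, (f x - g l x)) x l
    have h5 := (abs_le.1 (h x)).1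
    rw [hi, ← hl] at h5
    linarith

/-- Coefficients matter only up to a common shift. One exceeding the least by at least `K`, a bound
for all differences of generators, can be truncated to `K` without effect. Coefficients may thus be
taken in a compact cube. -/
theorem exists_mem_Icc_minComb_eq (hg : ∀ l, ∃ K, ∀ x, |g l x| ≤ K) :
    ∃ K : ℝ, ∀ c : L → ℝ, ∃ c' ∈ Set.Icc (0 : L → ℝ) (fun _ => K), ∃ k : ℝ,
      minComb g c' = fun x => minComb g c x + k := by
  choose B hB using hg
  set K := 2 * ∑ l, |B l|
  refine ⟨K, fun c => ?_⟩
  obtain ⟨m, hm⟩ := Finite.exists_min c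
  have hK : ∀ l k x, g l x - g k x ≤ K := fun l k x => by
    have a1 := Finset.single_le_sum (f := fun l => |B l|)
      (fun _ _ => abs_nonneg _) (Finset.mem_univ l)
    have a2 := Finset.single_le_sum (f := fun l => |B l|)
      (fun _ _ => abs_nonneg _) (Finset.mem_univ k)
    have := abs_le.1 ((hB l x).trans (le_abs_self _))
    have := abs_le.1 ((hB k x).trans (le_abs_self _))
    linarith
  have hK0 : 0 ≤ K := by positivity
  refine ⟨fun l => min (c l - c m) K, ⟨fun l => le_min (sub_nonneg.2 (hm l)) hK0,
    fun l => min_le_right _ _⟩, -c m, funext fun x => le_antisymm ?_ ?_⟩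
  · obtain ⟨l, hl⟩ := exists_activeAt g c x
    have h1 := minComb_le (g := g) (c := fun l => min (c l - c m) K) x l
    have h2 := min_le_left (c l - c m) K
    rw [hl.minComb_eq]
    linarith
  · refine Finset.le_inf' _ _ fun l _ => ?_
    change _ ≤ g l x + min (c l - c m) K
    rcases min_choice (c l - c m) K with h | h <;> rw [h]
    · linarith [minComb_le (g := g) (c := c) x l]
    · linarith [minComb_le (g := g) (c := c) x m, hK m l x]

end Span

/-! ### Limits of functions vanishing at nearby distinct points -/

section Limit

open Filter Topology

variable {L : Type*} {g : L → Γ.Point → ℝ} {D : Γ.Divisor}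

theorem ord_add_const [Fintype E] {f : Γ.Point → ℝ} (hf : f ∈ Γ.PL) (k : ℝ) (x : Γ.Point) :
    ord (fun y => f y + k) x = ord f x := by
  simp [ord, slope_add_const hf]

/-- If `c n` tends to `c` and `δ n` to zero, the functions active for `c n` at distance less than
`δ n` from `x` are active for `c` at `x`, for large `n`. -/
theorem IsChart.eventually_activeAt [Finite L] {x : Γ.Point} {η : Γ.Tangent x} {ε : ℝ}
    (hc : IsChart g D η ε) {cs : ℕ → L → ℝ} {c : L → ℝ} (hcs : Tendsto cs atTop (𝓝 c))
    {δ : ℕ → ℝ} (hδ : Tendsto δ atTop (𝓝 0)) (hδε : ∀ n, δ n ≤ ε) :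
    ∀ᶠ n in atTop, ∀ l, ∀ h ∈ Set.Ico 0 (δ n), ActiveAt g (cs n) (η.step h) l →
      ActiveAt g c x l := by
  refine eventually_all.2 fun l => ?_
  by_cases hl : ActiveAt g c x l
  · exact Eventually.of_forall fun _ _ _ _ => hl
  · simp only [ActiveAt, not_forall, not_le] at hl
    obtain ⟨k, hk⟩ := hl
    have hk' : ∀ m, Tendsto (fun n => cs n m) atTop (𝓝 (c m)) := tendsto_pi_nhds.1 hcs
    set s : ℝ := slope (g l) η - slope (g k) η with hs
    have ht : Tendsto (fun n => g l x + cs n l - (g k x + cs n k) - |s| * δ n) atTop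
        (𝓝 (g l x + c l - (g k x + c k) - |s| * 0)) :=
      (((hk' l).const_add _).sub ((hk' k).const_add _)).sub (hδ.const_mul _)
    filter_upwards [ht.eventually_const_lt (by linarith : (0 : ℝ) < _)] with n hn h hh hact
    have e1 := hact k
    have hh' : h ∈ Set.Icc 0 ε := ⟨hh.1, hh.2.le.trans (hδε n)⟩
    rw [hc.affine l h hh', hc.affine k h hh'] at e1
    have e2 : -|s| * h ≤ s * h := mul_le_mul_of_nonneg_right (neg_abs_le s) hh.1
    have e3 : |s| * h ≤ |s| * δ n := mul_le_mul_of_nonneg_left hh.2.le (abs_nonneg s)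
    exfalso
    have e4 : s * h = slope (g l) η * h - slope (g k) η * h := by rw [hs]; ring
    linarith

/-- Spreading a divisor of degree `r` out into distinct points and passing to the limit gives
functions whose slopes are dominated by many generators. -/
theorem exists_minComb_dominated [Fintype E] [Fintype L] [Nonempty L] (hg : ∀ l, g l ∈ Γ.PL)
    (hbdd : ∀ l, ∃ K, ∀ x, |g l x| ≤ K) (hne : ∀ x, Nonempty (Γ.Tangent x))
    (hR : ∀ c, minComb g c ∈ completeSeries D) {r : ℕ}
    (hrank : ∀ F : Γ.Divisor, 0 ≤ F → Divisor.degree F = r →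
      ∃ c, BakerNorineRank D F (minComb g c)) {F : Γ.Divisor} (hF : 0 ≤ F)
    (hdeg : Divisor.degree F = r) :
    ∃ c, BakerNorineRank D F (minComb g c) ∧ ∀ x, ∃ (η : Γ.Tangent x) (Λ : Finset L),
      F x + 1 ≤ Λ.card ∧ Set.InjOn (fun l => slope (g l) η) Λ ∧
      ∀ l ∈ Λ, ∀ ζ : Γ.Tangent x, slope (minComb g c) ζ ≤ slope (g l) ζ := by
  obtain ⟨K, hK⟩ := exists_mem_Icc_minComb_eq hbdd
  let η : ∀ x, Γ.Tangent x := fun x => (hne x).some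
  choose ε hε using fun x => exists_isChart hg D (η x)
  have hδ : ∀ (n : ℕ) x, 0 < ε x / (n + 1) := fun n x =>
    div_pos (hε x).pos (by positivity)
  -- The multiplicity `F x` is replaced by `F x` distinct points within distance `ε x / (n + 1)` of
  -- `x`, all in one direction.
  choose H hHc hH using fun (n : ℕ) x => exists_finset_Ioo (hδ n x) (F x).toNat
  have hFn : ∀ n : ℕ, ∃ c ∈ Set.Icc (0 : L → ℝ) (fun _ => K), ∀ x, ∀ h ∈ H n x,
      1 ≤ ord (minComb g c) ((η x).step h) + D ((η x).step h) := by
    intro n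
    let P : (Σ _ : Γ.Point, ℝ) → Γ.Point := fun p => (η p.1).step p.2
    obtain ⟨c, hc⟩ := hrank (Divisor.ofPoints (F.support.sigma (H n)) P)
      (Divisor.ofPoints_nonneg _ _) (by
        rw [Divisor.degree_ofPoints, Finset.card_sigma, ← hdeg, Divisor.degree, Finsupp.sum]
        push_cast
        refine Finset.sum_congr rfl fun x _ => ?_
        rw [hHc, Int.toNat_of_nonneg (hF x)])
    obtain ⟨c', hc', k, hk⟩ := hK c
    refine ⟨c', hc', fun x h hh => ?_⟩
    have hx : x ∈ F.support := Finsupp.mem_support_iff.2 fun h0 => by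
      have := Finset.card_pos.2 ⟨h, hh⟩
      rw [hHc, h0] at this
      simp at this
    rw [hk, ord_add_const (hR c).1]
    exact (Divisor.one_le_ofPoints P (i := ⟨x, h⟩) (Finset.mem_sigma.2 ⟨hx, hh⟩)).trans (hc _)
  choose cs hcs hbend using hFn
  obtain ⟨c, -, φ, hφ, hlim⟩ := isCompact_Icc.tendsto_subseq hcs
  have key : ∀ x, ∃ Λ : Finset L, F x + 1 ≤ Λ.card ∧
      Set.InjOn (fun l => slope (g l) (η x)) Λ ∧
      (∀ l ∈ Λ, ∀ ζ : Γ.Tangent x, slope (minComb g c) ζ ≤ slope (g l) ζ) ∧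
      F x ≤ ord (minComb g c) x + D x := by
    intro x
    have hδ0 : Tendsto (fun n => ε x / ((φ n : ℝ) + 1)) atTop (𝓝 0) := by
      have := (tendsto_const_div_atTop_nhds_zero_nat (ε x)).comp
        ((tendsto_add_atTop_nat 1).comp hφ.tendsto_atTop)
      refine this.congr fun n => ?_
      simp
    have hδε : ∀ n, ε x / ((φ n : ℝ) + 1) ≤ ε x := fun n =>
      div_le_self (hε x).pos.le (by linarith [(φ n).cast_nonneg (α := ℝ)])
    obtain ⟨n, hn⟩ := ((hε x).eventually_activeAt hlim hδ0 hδε).exists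
    obtain ⟨Λ, hΛ, hinj, hact⟩ := (hε x).exists_chain hg (hδ (φ n) x) (hδε n) (H (φ n) x)
      fun h hh => ⟨hH _ _ h hh, hbend _ x h hh⟩
    have hge : ∀ l, ActiveAt g c x l → ∀ ζ : Γ.Tangent x,
        slope (minComb g c) ζ ≤ slope (g l) ζ := fun l hl ζ =>
      (exists_slope_minComb_eq hg c ζ).elim fun _ h => h.2.2 l hl
    have hdom : ∀ l ∈ Λ, ∀ ζ : Γ.Tangent x, slope (minComb g c) ζ ≤ slope (g l) ζ :=
      fun l hl => by
        obtain ⟨⟨h, hh, ha⟩, -⟩ := hact l hl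
        exact hge l (hn l h hh ha)
    have hcard : F x + 1 ≤ Λ.card := by
      rw [hΛ, hHc]
      push_cast
      rw [Int.toNat_of_nonneg (hF x)]
    refine ⟨Λ, hcard, hinj, hdom, ?_⟩
    have hle : ∀ ζ : Γ.Tangent x,
        0 ≤ slope (minComb g (cs (φ n))) ζ - slope (minComb g c) ζ := fun ζ => by
      obtain ⟨l, hl, he, -⟩ := exists_slope_minComb_eq hg (cs (φ n)) ζ
      rw [he, sub_nonneg]
      refine hge l (hn l 0 ⟨le_rfl, hδ _ x⟩ ?_) ζ
      rwa [Tangent.step_zero]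
    -- At least `F x + 1` distinct integer slopes lie between the two. Since no slope increases in
    -- the limit, the order at `x` gains at least `F x`, while `D + div` was nonnegative before.
    have hjump : F x ≤ slope (minComb g (cs (φ n))) (η x) - slope (minComb g c) (η x) := by
      have h1 : Λ.image (fun l => slope (g l) (η x)) ⊆
          Finset.Icc (slope (minComb g c) (η x)) (slope (minComb g (cs (φ n))) (η x)) := by
        intro s hs
        obtain ⟨l, hl, rfl⟩ := Finset.mem_image.1 hs
        exact Finset.mem_Icc.2 ⟨hdom l hl _, (hact l hl).2⟩
      have h2 := Finset.card_le_card h1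
      rw [Finset.card_image_of_injOn hinj, Int.card_Icc] at h2
      have := hle (η x)
      omega
    have hsum := Finset.single_le_sum
      (f := fun ζ => slope (minComb g (cs (φ n))) ζ - slope (minComb g c) ζ)
      (fun ζ _ => hle ζ) (Finset.mem_univ (η x))
    rw [Finset.sum_sub_distrib] at hsum
    have h0 := (hR (cs (φ n))).2 x
    simp only [ord] at h0 ⊢
    linarith
  refine ⟨c, fun x => ?_, fun x => ?_⟩
  · obtain ⟨_, _, _, _, h⟩ := key x
    exact h
  · obtain ⟨Λ, h1, h2, h3, _⟩ := key x
    exact ⟨η x, Λ, h1, h2, h3⟩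

end Limit

end MetricGraph

/-! ### Construction of the slope structure -/

theorem Finset.orderEmbOfFin_add_rev_eq_zero {s t : Finset ℤ} {n : ℕ} (hs : s.card = n + 1)
    (ht : t.card = n + 1) (hst : ∀ a ∈ t, -a ∈ s) (i : Fin (n + 1)) :
    s.orderEmbOfFin hs i + t.orderEmbOfFin ht i.rev = 0 := by
  -- Negation reverses the order, and the increasing enumeration of a finite set is unique.
  have h := Finset.orderEmbOfFin_unique hs (f := fun i => -t.orderEmbOfFin ht i.rev)
    (fun i => hst _ (Finset.orderEmbOfFin_mem _ _ _)) fun i j hij =>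
      neg_lt_neg ((t.orderEmbOfFin ht).strictMono (Fin.rev_lt_rev.2 hij))
  rw [← congrFun h i]
  ring

namespace MetricGraph

variable {V E : Type*} {Γ : MetricGraph V E}

/-- The free parameters cover both the vectors facing each other from the two ends of a segment (`p
= a`, `q = b`) and the two vectors at an inner point (`p = q`). -/
theorem slope_add_slope_eq_zero_of_segment {f : Γ.Point → ℝ} {x y : Γ.Point} {η : Γ.Tangent x}
    {ξ : Γ.Tangent y} {e : E} {a p q b : ℝ} {s : ℤ} (hap : a ≤ p) (hqb : q ≤ b) (hpb : p < b)
    (haq : a < q) (hη : ∀ h, η.step h = Γ.edgePoint e (p + h))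
    (hξ : ∀ h, ξ.step h = Γ.edgePoint e (q - h))
    (hs : ∀ t ∈ Set.Icc a b, f (Γ.edgePoint e t) = f (Γ.edgePoint e a) + s * (t - a)) :
    slope f η + slope f ξ = 0 := by
  have hx := hη 0
  have hy := hξ 0
  rw [Tangent.step_zero, add_zero] at hx
  rw [Tangent.step_zero, sub_zero] at hy
  have h1 : HasSlope f η s := ⟨b - p, sub_pos.2 hpb, fun h hh => by
    rw [hη, congrArg f hx, hs _ ⟨by linarith [hh.1], by linarith [hh.2]⟩, hs p ⟨hap, hpb.le⟩]
    ring⟩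
  have h2 : HasSlope f ξ (-s) := ⟨q - a, sub_pos.2 haq, fun h hh => by
    rw [hξ, congrArg f hy, hs _ ⟨by linarith [hh.2], by linarith [hh.1]⟩, hs q ⟨haq.le, hqb⟩]
    push_cast
    ring⟩
  rw [h1.slope_eq, h2.slope_eq, add_neg_cancel]

/-- Away from finitely many points, finitely many piecewise linear functions do not bend. -/
theorem exists_breakSet [Finite V] [Finite E] {L : Type*} [Finite L] {g : L → Γ.Point → ℝ}
    (hg : ∀ l, g l ∈ Γ.PL) : ∃ W : Set Γ.Point, W.Finite ∧ (∀ x, Γ.valence x ≠ 2 → x ∈ W) ∧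
      (∀ (x y : Γ.Point) (η : Γ.Tangent x) (ξ : Γ.Tangent y), η.edge = ξ.edge →
        η.forward = true → ξ.forward = false → η.pos < ξ.pos →
        (∀ t ∈ Set.Ioo η.pos ξ.pos, Γ.edgePoint η.edge t ∉ W) →
        ∀ l, slope (g l) η + slope (g l) ξ = 0) ∧
      ∀ x, x ∉ W → ∀ η ξ : Γ.Tangent x, η ≠ ξ → ∀ l, slope (g l) η + slope (g l) ξ = 0 := by
  choose B hB using hg
  -- All vertices of the model, even those of valence 2, and all break points are taken; only inner
  -- points of edges remain outside.
  refine ⟨Set.range Point.vertex ∪ ⋃ l, ⋃ e, Γ.edgePoint e '' (B l e), ?_, fun x hx => ?_, ?_, ?_⟩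
  · exact (Set.finite_range _).union (Set.finite_iUnion fun l => Set.finite_iUnion fun e =>
      (B l e).finite_toSet.image _)
  · rcases x with v | ⟨e, t, h0, h1⟩
    · exact Or.inl ⟨v, rfl⟩
    · obtain ⟨ζ, ζ', hne, hall, -⟩ :=
        exists_tangents_of_eq_inner (Γ := Γ) (y := .inner e t h0 h1) rfl
      refine absurd ?_ hx
      exact Nat.card_eq_two_iff.2 ⟨ζ, ζ', hne, Set.eq_univ_of_forall fun ξ => by
        simpa using hall ξ⟩
  · intro x y η ξ he hf hb hlt hW l
    obtain ⟨s, hs⟩ := hB l η.edge η.pos ξ.pos η.pos_bounds.1 hlt (he ▸ ξ.pos_bounds.2.1)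
      fun t ht htB => hW t ht (Or.inr (Set.mem_iUnion₂.2 ⟨l, η.edge, t, htB, rfl⟩))
    refine slope_add_slope_eq_zero_of_segment le_rfl le_rfl hlt hlt (fun h => ?_) (fun h => ?_) hs
    · simp [Tangent.step, hf]
    · simp [Tangent.step, hb, he]
  · intro x hx η ξ hne l
    rcases x with v | ⟨e, t, h0, h1⟩
    · exact absurd (Or.inl ⟨v, rfl⟩) hx
    · have ht : t ∉ B l e := fun htB => hx (Or.inr (Set.mem_iUnion₂.2 ⟨l, e, t, htB,
        edgePoint_of_mem_Ioo h0 h1⟩))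
      have hn : ((B l e : Set ℝ)ᶜ ∩ Set.Ioo 0 (Γ.len e)) ∈ nhds t :=
        Filter.inter_mem ((B l e).finite_toSet.isClosed.isOpen_compl.mem_nhds ht)
          (Ioo_mem_nhds h0 h1)
      obtain ⟨a, b, htab, hab⟩ := mem_nhds_iff_exists_Ioo_subset.1 hn
      have ha : (a + t) / 2 ∈ Set.Ioo a b := ⟨by linarith [htab.1], by linarith [htab.1, htab.2]⟩
      have hb : (t + b) / 2 ∈ Set.Ioo a b := ⟨by linarith [htab.1, htab.2], by linarith [htab.2]⟩
      have hat : (a + t) / 2 < t := by linarith [htab.1]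
      have htb : t < (t + b) / 2 := by linarith [htab.2]
      obtain ⟨s, hs⟩ := hB l e ((a + t) / 2) ((t + b) / 2) (hab ha).2.1.le (hat.trans htb)
        (hab hb).2.2.le fun u hu huB => (hab ⟨ha.1.trans hu.1, hu.2.trans hb.2⟩).1 huB
      obtain ⟨ζ, ζ', -, hall, hζ, hζ'⟩ :=
        exists_tangents_of_eq_inner (Γ := Γ) (y := .inner e t h0 h1) rfl
      have key : slope (g l) ζ + slope (g l) ζ' = 0 :=
        slope_add_slope_eq_zero_of_segment hat.le htb.le htb hat hζ hζ' hs
      rcases hall η with rfl | rfl <;> rcases hall ξ with rfl | rfl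
      · exact absurd rfl hne
      · exact key
      · rw [add_comm]; exact key
      · exact absurd rfl hne

section Structure

variable {L : Type*} {g : L → Γ.Point → ℝ} {r : ℕ}

theorem exists_index [Fintype L]
    (hcard : ∀ x (η : Γ.Tangent x), (Finset.univ.image fun l => slope (g l) η).card = r + 1)
    {x : Γ.Point} (η : Γ.Tangent x) (l : L) :
    ∃ i, (Finset.univ.image fun l => slope (g l) η).orderEmbOfFin (hcard x η) i =
      slope (g l) η := by
  have : slope (g l) η ∈ Set.range
      ((Finset.univ.image fun l => slope (g l) η).orderEmbOfFin (hcard x η)) := by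
    rw [Finset.range_orderEmbOfFin]
    exact Finset.mem_coe.2 (Finset.mem_image_of_mem _ (Finset.mem_univ l))
  exact this

/-- The array of the slope vectors of the functions `g l` with `IsDot g x l`, for an increasing
enumeration `S` of the slopes. -/
def dotArray (g : L → Γ.Point → ℝ) (S : (x : Γ.Point) → Γ.Tangent x → Fin (r + 1) → ℤ)
    (x : Γ.Point) : DotArray (Γ.Tangent x) r :=
  {y | ∃ l, IsDot g x l ∧ ∀ ζ, S x ζ (y ζ) = slope (g l) ζ}

/-- Two dots sharing one slope dominate each other, hence have the same slope vector. -/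
theorem existsUnique_dotArray {S : (x : Γ.Point) → Γ.Tangent x → Fin (r + 1) → ℤ} {x : Γ.Point}
    (hS : ∀ η : Γ.Tangent x, StrictMono (S x η))
    (hl : ∀ (η : Γ.Tangent x) i, ∃ l, slope (g l) η = S x η i)
    (hi : ∀ (η : Γ.Tangent x) l, ∃ i, S x η i = slope (g l) η)
    (hdot : ∀ (η : Γ.Tangent x) l, ∃ d, IsDot g x d ∧ slope (g d) η = slope (g l) η)
    (η : Γ.Tangent x) (a : Fin (r + 1)) : ∃! y, y ∈ dotArray g S x ∧ y η = a := by
  obtain ⟨l, hl⟩ := hl η a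
  obtain ⟨d, hd, hdl⟩ := hdot η l
  choose y hy using fun ζ => hi ζ d
  refine ⟨y, ⟨⟨d, hd, hy⟩, (hS η).injective (by rw [hy, hdl, hl])⟩, ?_⟩
  rintro z ⟨⟨k, hk, hz⟩, hza⟩
  have hkd : slope (g k) η = slope (g d) η := by rw [← hz, hza, hdl, hl]
  refine funext fun ζ => (hS ζ).injective ?_
  rw [hz, hy]
  exact le_antisymm (hd k ⟨η, hkd⟩ ζ) (hk d ⟨η, hkd.symm⟩ ζ)

/-- Where no generator bends, one slope determines the other, so every generator is a dot and its
two indices add up to `r`. -/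
theorem dotArray_eq_standard [Fintype E] {S : (x : Γ.Point) → Γ.Tangent x → Fin (r + 1) → ℤ} {x : Γ.Point}
    (hS : ∀ η : Γ.Tangent x, StrictMono (S x η))
    (hl : ∀ (η : Γ.Tangent x) i, ∃ l, slope (g l) η = S x η i) (hval : Γ.valence x = 2)
    (hopp : ∀ η ξ : Γ.Tangent x, η ≠ ξ → ∀ i, S x η i + S x ξ i.rev = 0)
    (hg : ∀ η ξ : Γ.Tangent x, η ≠ ξ → ∀ l, slope (g l) η + slope (g l) ξ = 0) :
    dotArray g S x = DotArray.standard (Γ.Tangent x) r := by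
  classical
  obtain ⟨ζ, ζ', hne, hall⟩ := Nat.card_eq_two_iff.1 hval
  have hall : ∀ ξ, ξ = ζ ∨ ξ = ζ' := fun ξ => by
    have := hall.ge (Set.mem_univ ξ)
    simpa using this
  have huniv : (Finset.univ : Finset (Γ.Tangent x)) = {ζ, ζ'} := by
    ext ξ; simpa using hall ξ
  have hsum : ∀ y : Γ.Tangent x → Fin (r + 1), ∑ i, (y i : ℕ) = r ↔ y ζ' = (y ζ).rev := by
    intro y
    rw [huniv, Finset.sum_pair hne, Fin.ext_iff, Fin.val_rev]
    have := (y ζ).isLt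
    omega
  ext y
  refine Iff.trans ?_ (hsum y).symm
  constructor
  · rintro ⟨l, -, hy⟩
    refine (hS ζ').injective ?_
    have h1 := hopp ζ ζ' hne (y ζ)
    have h2 := hg ζ ζ' hne l
    have h3 := hy ζ
    have h4 := hy ζ'
    omega
  · intro hy
    obtain ⟨l, hl⟩ := hl ζ (y ζ)
    have h2 := hg ζ ζ' hne l
    refine ⟨l, fun k ⟨ξ, hξ⟩ ξ' => ?_, fun ξ => ?_⟩
    · have h1 := hg ζ ζ' hne k
      rcases hall ξ with rfl | rfl <;> rcases hall ξ' with rfl | rfl <;> omega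
    · rcases hall ξ with rfl | rfl
      · exact hl.symm
      · have h1 := hopp ζ ξ hne (y ζ)
        rw [hy]
        omega

theorem exists_slopeStructure [Fintype E] [Fintype L]
    (hcard : ∀ x (η : Γ.Tangent x), (Finset.univ.image fun l => slope (g l) η).card = r + 1)
    (hdot : ∀ x (η : Γ.Tangent x) l, ∃ d, IsDot g x d ∧ slope (g d) η = slope (g l) η)
    {W : Set Γ.Point} (hfin : W.Finite) (hval : ∀ x, Γ.valence x ≠ 2 → x ∈ W)
    (hseg : ∀ (x y : Γ.Point) (η : Γ.Tangent x) (ξ : Γ.Tangent y), η.edge = ξ.edge →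
      η.forward = true → ξ.forward = false → η.pos < ξ.pos →
      (∀ t ∈ Set.Ioo η.pos ξ.pos, Γ.edgePoint η.edge t ∉ W) →
      ∀ l, slope (g l) η + slope (g l) ξ = 0)
    (hpt : ∀ x, x ∉ W → ∀ η ξ : Γ.Tangent x, η ≠ ξ → ∀ l, slope (g l) η + slope (g l) ξ = 0) :
    ∃ 𝔖 : SlopeStructure Γ W r, (∀ x η l, ∃ i, 𝔖.S x η i = slope (g l) η) ∧
      (∀ x, 𝔖.P x = dotArray g 𝔖.S x) ∧
      ∀ x (η : Γ.Tangent x) a, ∃! y, y ∈ 𝔖.P x ∧ y η = a := by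
  classical
  let S : (x : Γ.Point) → Γ.Tangent x → Fin (r + 1) → ℤ := fun x η =>
    (Finset.univ.image fun l => slope (g l) η).orderEmbOfFin (hcard x η)
  have hS : ∀ x η, StrictMono (S x η) := fun x η => (Finset.orderEmbOfFin _ _).strictMono
  have hi : ∀ x η l, ∃ i, S x η i = slope (g l) η := fun x η l => exists_index hcard η l
  have hl : ∀ x (η : Γ.Tangent x) i, ∃ l, slope (g l) η = S x η i := fun x η i => by
    obtain ⟨l, -, hl⟩ := Finset.mem_image.1 (Finset.orderEmbOfFin_mem _ (hcard x η) i)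
    exact ⟨l, hl⟩
  have hrev : ∀ (x y : Γ.Point) (η : Γ.Tangent x) (ξ : Γ.Tangent y),
      (∀ l, slope (g l) η + slope (g l) ξ = 0) → ∀ i, S x η i + S y ξ i.rev = 0 := by
    intro x y η ξ h i
    refine Finset.orderEmbOfFin_add_rev_eq_zero _ _ (fun a ha => ?_) i
    obtain ⟨l, -, rfl⟩ := Finset.mem_image.1 ha
    refine Finset.mem_image.2 ⟨l, Finset.mem_univ l, ?_⟩
    have := h l
    omega
  have hdots := fun x => existsUnique_dotArray (hS x) (hl x) (hi x) (hdot x)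
  refine ⟨⟨hfin, hval, S, hS, dotArray g S, fun x =>
    DotArray.isPermutationArray_of_existsUnique (hdots x),
    fun x y η ξ h1 h2 h3 h4 h5 => hrev x y η ξ (hseg x y η ξ h1 h2 h3 h4 h5),
    fun x hx η ξ hne => hrev x x η ξ (hpt x hx η ξ hne), fun x hx => ?_⟩, hi, fun x => rfl, hdots⟩
  exact dotArray_eq_standard (hS x) (hl x) (by_contra fun h => hx (hval x h))
    (fun η ξ hne => hrev x x η ξ (hpt x hx η ξ hne)) (hpt x hx)

variable [Fintype E] {W : Set Γ.Point} {𝔖 : SlopeStructure Γ W r}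

theorem SlopeStructure.S_jump {f : Γ.Point → ℝ} {x : Γ.Point} {η : Γ.Tangent x}
    (h : ∃ i, 𝔖.S x η i = slope f η) : 𝔖.S x η (𝔖.jump f x η) = slope f η :=
  Function.invFun_eq h

/-- A function whose slopes are dominated by those of a dot has its jump vector below this dot. -/
theorem SlopeStructure.exists_mem_P {f : Γ.Point → ℝ} {x : Γ.Point}
    (hi : ∀ (η : Γ.Tangent x) l, ∃ i, 𝔖.S x η i = slope (g l) η)
    (hP : 𝔖.P x = dotArray g 𝔖.S x) (hf : ∀ η : Γ.Tangent x, ∃ i, 𝔖.S x η i = slope f η)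
    (hdot : ∀ (η : Γ.Tangent x) l, ∃ d, IsDot g x d ∧ slope (g d) η = slope (g l) η)
    {l : L} (hl : ∀ ζ : Γ.Tangent x, slope f ζ ≤ slope (g l) ζ) (η : Γ.Tangent x) :
    ∃ y ∈ 𝔖.P x, 𝔖.S x η (y η) = slope (g l) η ∧ 𝔖.jump f x ≤ y := by
  obtain ⟨d, hd, hdl⟩ := hdot η l
  choose y hy using fun ζ => hi ζ d
  refine ⟨y, hP ▸ ⟨d, hd, hy⟩, (hy η).trans hdl, fun ζ => ?_⟩
  rw [← (𝔖.strictMono x ζ).le_iff_le, S_jump (hf ζ), hy]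
  exact (hl ζ).trans (hd l ⟨η, hdl.symm⟩ ζ)

end Structure

/-! ### Admissibility and the theorem -/

/-- A tropical linear series is admissible if every point has one or two tangent vectors. -/
theorem IsTropicalLinearSeries.isAdmissible [Finite V] [Fintype E] [Nonempty Γ.Point]
    (hΓ : ∀ x, Γ.ThinAt x) {r : ℕ} {D : Γ.Divisor} {M : Set (Γ.Point → ℝ)}
    (h : IsTropicalLinearSeries r D M) : IsAdmissible r D M := by
  obtain ⟨x₀⟩ := (inferInstance : Nonempty Γ.Point)
  obtain ⟨G, hG, hMG⟩ := h.finitelyGenerated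
  let g : G → Γ.Point → ℝ := Subtype.val
  have := hG.fintype
  have hrange : Set.range g = G := Subtype.range_coe
  have : Nonempty G := by
    obtain ⟨f, hf, -⟩ := h.rank (Finsupp.single x₀ r) (Finsupp.single_nonneg.2 (by simp))
      (Divisor.degree_single _ _)
    rw [hMG] at hf
    obtain ⟨n, u, a, hu, -⟩ := hf
    exact ⟨⟨u 0, hu 0⟩⟩
  have hgM : ∀ l, g l ∈ M := fun l => by
    rw [hMG]
    exact ⟨0, fun _ => g l, fun _ => 0, fun _ => l.2, funext fun x => by simp [tropComb]⟩
  have hg : ∀ l, g l ∈ Γ.PL := fun l => (h.subset (hgM l)).1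
  have hbdd : ∀ l, ∃ K, ∀ x, |g l x| ≤ K := fun l => bounded_of_mem_PL (hg l)
  have hcM : ∀ c, minComb g c ∈ M := fun c => by
    have := minComb_mem_tropSpan g c
    rwa [hrange, ← hMG] at this
  have happ : ∀ f ∈ Γ.PL, (∀ ε > 0, ∃ u ∈ M, ∀ x, |f x - u x| ≤ ε) → ∃ c, f = minComb g c :=
    fun f hf hfa => exists_eq_minComb_of_approx hbdd (bounded_of_mem_PL hf) (by
      rwa [hrange, ← hMG])
  -- An element of the span may omit generators; approximating it by itself rewrites it as a minimum
  -- over all of them.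
  have hMc : ∀ f ∈ M, ∃ c, f = minComb g c := fun f hf =>
    happ f (h.subset hf).1 fun ε hε => ⟨f, hf, fun x => by simpa using hε.le⟩
  have hrank : ∀ F : Γ.Divisor, 0 ≤ F → Divisor.degree F = r →
      ∃ c, BakerNorineRank D F (minComb g c) := fun F hF hd => by
    obtain ⟨f, hf, hfF⟩ := h.rank F hF hd
    obtain ⟨c, rfl⟩ := hMc f hf
    exact ⟨c, hfF⟩
  have hcirc := fun x (R : Finset G) =>
    exists_isCircuit (T := R) h.dependent hg hgM Subtype.val_injective x
  have hdot := fun x (η : Γ.Tangent x) l => exists_isDot hg hrank (hcirc x) (hΓ x) η l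
  have hne : ∀ x, Nonempty (Γ.Tangent x) := fun x => (hΓ x).elim fun η _ => ⟨η⟩
  obtain ⟨W, hfin, hval, hseg, hpt⟩ := exists_breakSet hg
  obtain ⟨𝔖, hi, hP, hdots⟩ := exists_slopeStructure
    (fun x η => card_image_slope hg hrank (hcirc x) η) hdot hfin hval hseg hpt
  have hci : ∀ c x (η : Γ.Tangent x), ∃ i, 𝔖.S x η i = slope (minComb g c) η := fun c x η => by
    obtain ⟨l, -, he, -⟩ := exists_slope_minComb_eq hg c η
    rw [he]
    exact hi x η l
  refine ⟨fun f hf hfa => ?_, W, 𝔖, fun f hf => ⟨h.subset hf, (h.subset hf).1, ?_⟩,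
    fun F hF hd => ?_⟩
  · obtain ⟨c, rfl⟩ := happ f hf hfa
    exact hcM c
  · obtain ⟨c, rfl⟩ := hMc f hf
    refine ⟨hci c, fun x => DotArray.mem_redundantClosure_of_forall_exists fun η => ?_⟩
    obtain ⟨l, hl, he, -⟩ := exists_slope_minComb_eq hg c η
    obtain ⟨y, hy, hyl, hle⟩ := SlopeStructure.exists_mem_P (hi x) (hP x) (hci c x) (hdot x)
      (fun ζ => (exists_slope_minComb_eq hg c ζ).elim fun _ h => h.2.2 l hl) η
    refine ⟨y, hy, (𝔖.strictMono x η).injective ?_, hle⟩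
    rw [hyl, SlopeStructure.S_jump (hci c x η), he]
  · obtain ⟨c, hBN, hdom⟩ :=
      exists_minComb_dominated hg hbdd hne (fun c => h.subset (hcM c)) hrank hF hd
    refine ⟨_, hcM c, hBN, fun x => ?_⟩
    obtain ⟨η, Λ, hcard, hinj, hΛ⟩ := hdom x
    -- Each generator in `Λ` lies below a dot with the same slope along `η`; these slopes being
    -- distinct, so are the dots.
    have hex : ∀ l : Λ, ∃ y ∈ 𝔖.P x, 𝔖.S x η (y η) = slope (g l) η ∧
        𝔖.jump (minComb g c) x ≤ y := fun l =>
      SlopeStructure.exists_mem_P (hi x) (hP x) (hci c x) (hdot x) (hΛ l l.2) η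
    choose y hyP hyl hle using hex
    have hyinj : Function.Injective y := fun l m hlm =>
      Subtype.ext (hinj l.2 m.2 (by simp only [← hyl, hlm]))
    classical
    refine DotArray.le_rankArray (hdots x) (Finset.univ.image y) (fun z hz => ?_) ?_
    · obtain ⟨l, -, rfl⟩ := Finset.mem_image.1 hz
      exact ⟨hyP l, hle l⟩
    · rwa [Finset.card_image_of_injective _ hyinj, Finset.card_univ, Fintype.card_coe]

end MetricGraph

theorem mainTheorem6 {V E : Type*} [Fintype V] [Fintype E] (Γ : MetricGraph V E)
    (hΓ : Γ.IsInterval ∨ Γ.IsLoop) (r : ℕ) (D : Γ.Divisor) (M : Set (Γ.Point → ℝ)) :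
    MetricGraph.IsTropicalLinearSeries r D M ↔
      MetricGraph.IsCombinatorialLimitLinearSeries r D M := by
  constructor
  · intro h
    have := MetricGraph.nonempty_point_of_isInterval_or_isLoop hΓ
    exact ⟨h.subset, h.submodule, h.finitelyGenerated,
      h.isAdmissible (MetricGraph.thinAt_of_isInterval_or_isLoop hΓ), h.dependent⟩
  · intro h
    obtain ⟨-, W, 𝔖, -, hrank⟩ := h.admissible
    exact ⟨h.subset, h.submodule, h.finitelyGenerated, fun F hF hd =>
      (hrank F hF hd).imp fun f hf => ⟨hf.1, hf.2.1⟩, h.dependent⟩
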